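/- Let $c\ge 0$ and $\mathbb H_c=L^2(\mathbb R,e^{-2ct}\,dt)$ (complex-valued functions). Let $\partial_c$ be the operator $\partial_c f=f'$ on $\mathbb H_c$ with domain $D(\partial_c)=\{f\in\mathbb H_c : f \text{ locally absolutely continuous},\ f'\in\mathbb H_c\}$. It is normal and $\partial_c=c+iV_c$ with $V_c=(\partial_c-c)/i$ self-adjoint. For $0\le T_0<T$, a $(T_0,T)$-admissible cut-off function is a function $\varphi:\mathbb R\to\mathbb R$ for which there is a finite set $F\subset\mathbb R$ (empty if $T_0=0$) such that $\varphi$ is continuous on $\mathbb R\setminus F$, the closure of $\varphi(\mathbb R\setminus F)$ equals $\{\tau\in\mathbb R: T_0\le|\tau|\le T\}$, and, if $c=1$, $\varphi|_{\mathbb R\setminus F}$ extends to a holomorphic function on a neighbourhood of $\mathbb R\setminus F$ in $\mathbb C$. The corresponding $(T_0,T)$-truncated spectral operator is $\mathfrak a_c^{(T_0,T)}=\zeta\bigl(c+i\varphi(V_c)\bigr)$, where $\zeta$ is the Riemann zeta function and both functions of operators are taken in the measurable functional calculus for (possibly unbounded) normal operators. A possibly unbounded operator $A$ on $\mathbb H_c$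 with domain $D(A)$ is invertible if there is a bounded operator $B$, defined on all of $\mathbb H_c$ and with range $D(A)$, such that $ABu=u$ for all $u\in\mathbb H_c$ and $BAv=v$ for all $v\in D(A)$. The spectral operator $\mathfrak a_c=\zeta(\partial_c)$ is called almost invertible if there is $T_0\ge 0$ such that for every $T>T_0$ the truncated spectral operator $\mathfrak a_c^{(T_0,T)}$ is invertible. Then $\mathfrak a_c$ is almost invertible if and only if $\zeta$ has at most finitely many zeros on the line $\operatorname{Re}s=c$. This holds both when, in the definition of almost invertibility, invertibility is required for every $(T_0,T)$-admissible $\varphi$ and when it is required only for some $(T_0,T)$-admissible $\varphi$ for each $T>T_0$. -/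

import Mathlib

open MeasureTheory
open scoped ENNReal InnerProductSpace

noncomputable section

/-! ### The weighted Hilbert space and the infinitesimal shift -/

/-- The measure `μ_c(dt) = e^{-2ct} dt` on the real line. -/
def weightMeasure (c : ℝ) : Measure ℝ :=
  volume.withDensity fun t => ENNReal.ofReal (Real.exp (-2 * c * t))

/-- The Hilbert space `ℍ_c = L²(ℝ, e^{-2ct} dt)` of complex-valued functions. -/
abbrev WeightedL2 (c : ℝ) : Type := Lp ℂ 2 (weightMeasure c)

/-- (Locally) absolutely continuous functions on the real line. -/
def IsLocallyAC (g : ℝ → ℂ) : Prop :=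
  ∀ a b : ℝ, AbsolutelyContinuousOnInterval g a b

theorem IsLocallyAC.continuous {g : ℝ → ℂ} (hg : IsLocallyAC g) : Continuous g := by
  rw [continuous_iff_continuousAt]
  intro x
  have h := (hg (x - 1) (x + 1)).continuousOn
  rw [Set.uIcc_of_le (by linarith)] at h
  exact h.continuousAt (Icc_mem_nhds (by linarith) (by linarith))

theorem IsLocallyAC.ae_differentiableAt {g : ℝ → ℂ} (hg : IsLocallyAC g) :
    ∀ᵐ t : ℝ, DifferentiableAt ℝ g t := by
  have h : LocallyBoundedVariationOn g Set.univ := by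
    intro a b _ _
    rcases le_total a b with hab | hab
    · have := (hg a b).boundedVariationOn
      rw [Set.uIcc_of_le hab] at this
      exact this.mono Set.inter_subset_right
    · have := (hg b a).boundedVariationOn
      rw [Set.uIcc_of_le hab] at this
      refine this.mono ?_
      rintro x ⟨-, hx1, hx2⟩
      exact ⟨hab.trans hx1, hx2.trans hab⟩
  exact h.ae_differentiableAt

theorem weightMeasure_ae_iff (c : ℝ) {p : ℝ → Prop} :
    (∀ᵐ t ∂(weightMeasure c), p t) ↔ ∀ᵐ t : ℝ, p t := by
  have hm : Measurable fun t : ℝ => ENNReal.ofReal (Real.exp (-2 * c * t)) := by fun_prop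
  rw [weightMeasure, ae_withDensity_iff hm]
  have : ∀ t : ℝ, ENNReal.ofReal (Real.exp (-2 * c * t)) ≠ 0 := fun t => by
    simp [Real.exp_pos]
  simp only [ne_eq, this, not_false_eq_true, forall_const]

/-- The graph of `∂_c`: the pairs `(f, f')` with `f ∈ ℍ_c` (locally) absolutely continuous
and `f' ∈ ℍ_c`. -/
def shiftGraph (c : ℝ) : Submodule ℂ (WeightedL2 c × WeightedL2 c) where
  carrier := {p | ∃ g : ℝ → ℂ, IsLocallyAC g ∧
    (p.1 : ℝ → ℂ) =ᵐ[weightMeasure c] g ∧ (p.2 : ℝ → ℂ) =ᵐ[weightMeasure c] deriv g}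
  zero_mem' := by
    refine ⟨fun _ => 0, fun a b => ?_, Lp.coeFn_zero _ _ _, ?_⟩
    · exact (LipschitzWith.const (0 : ℂ)).lipschitzOnWith.absolutelyContinuousOnInterval
    · rw [deriv_const']
      exact Lp.coeFn_zero ℂ 2 (weightMeasure c)
  add_mem' := by
    rintro p q ⟨g, hg, hp1, hp2⟩ ⟨k, hk, hq1, hq2⟩
    refine ⟨g + k, fun a b => (hg a b).add (hk a b), ?_, ?_⟩
    · exact (Lp.coeFn_add _ _).trans (hp1.add hq1)
    · have hgd := (weightMeasure_ae_iff c).2 hg.ae_differentiableAt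
      have hkd := (weightMeasure_ae_iff c).2 hk.ae_differentiableAt
      filter_upwards [Lp.coeFn_add p.2 q.2, hp2, hq2, hgd, hkd] with t h1 h2 h3 h4 h5
      rw [deriv_add h4 h5, ← h2, ← h3]
      exact h1
  smul_mem' := by
    rintro a p ⟨g, hg, hp1, hp2⟩
    refine ⟨a • g, fun x y => (hg x y).const_smul a, ?_, ?_⟩
    · exact (Lp.coeFn_smul _ _).trans (hp1.const_smul a)
    · have hgd := (weightMeasure_ae_iff c).2 hg.ae_differentiableAt
      filter_upwards [Lp.coeFn_smul a p.2, hp2, hgd] with t h1 h2 h3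
      rw [deriv_const_smul a h3, ← h2]
      exact h1

theorem shiftGraph_single_valued (c : ℝ) :
    ∀ p ∈ shiftGraph c, p.1 = 0 → p.2 = 0 := by
  rintro p ⟨g, hg, h1, h2⟩ h0
  have hz : g =ᵐ[volume] fun _ => (0 : ℂ) := by
    refine (weightMeasure_ae_iff c).1 ?_
    rw [h0] at h1
    filter_upwards [h1, Lp.coeFn_zero ℂ 2 (weightMeasure c)] with t ht ht'
    rw [← ht, ht']
    rfl
  have hg0 : g = fun _ => 0 := (hg.continuous.ae_eq_iff_eq _ continuous_const).1 hz
  rw [Lp.eq_zero_iff_ae_eq_zero]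
  filter_upwards [h2] with t ht
  simp [ht, hg0]

/-- The infinitesimal shift `∂_c f = f'` with domain
`D(∂_c) = {f ∈ ℍ_c ∩ AC(ℝ) : f' ∈ ℍ_c}`. -/
def infinitesimalShift (c : ℝ) : WeightedL2 c →ₗ.[ℂ] WeightedL2 c :=
  (shiftGraph c).toLinearPMap

/-- The operator `V_c = (∂_c - c) / i`, with `D(V_c) = D(∂_c)`. -/
def momentumOperator (c : ℝ) : WeightedL2 c →ₗ.[ℂ] WeightedL2 c :=
  Complex.I⁻¹ • (((-(c : ℂ)) • LinearMap.id (R := ℂ) (M := WeightedL2 c)) +ᵥ infinitesimalShift c)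

/-! ### The measurable functional calculus of (unbounded) normal operators -/

section FunctionalCalculus

variable {H : Type*} [NormedAddCommGroup H] [InnerProductSpace ℂ H] [CompleteSpace H]

/-- A resolution of the identity (projection-valued Borel measure) on `ℂ` acting in `H`. Only the
values on Borel sets matter. -/
structure ResolutionOfIdentity (H : Type*) [NormedAddCommGroup H] [InnerProductSpace ℂ H]
    [CompleteSpace H] where
  proj : Set ℂ → H →L[ℂ] H
  isStarProjection : ∀ S, MeasurableSet S → IsStarProjection (proj S)
  empty : proj ∅ = 0
  univ : proj Set.univ = 1
  inter : ∀ S S', MeasurableSet S → MeasurableSet S' → proj (S ∩ S') = proj S * proj S'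
  iUnion : ∀ S : ℕ → Set ℂ, (∀ n, MeasurableSet (S n)) → Pairwise (Function.onFun Disjoint S) →
    ∀ x, HasSum (fun n => proj (S n) x) (proj (⋃ n, S n) x)

/-- The finite positive measure `S ↦ ⟨x, E(S) x⟩`. -/
def ResolutionOfIdentity.diagMeasure (E : ResolutionOfIdentity H) (x : H) : Measure ℂ :=
  Measure.ofMeasurable (fun S _ => ENNReal.ofReal (RCLike.re ⟪x, E.proj S x⟫_ℂ))
    (by simp [E.empty])
    (by
      intro S hS hd
      have hs : HasSum (fun n => RCLike.re ⟪x, E.proj (S n) x⟫_ℂ)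
          (RCLike.re ⟪x, E.proj (⋃ n, S n) x⟫_ℂ) :=
        (RCLike.reCLM (K := ℂ)).hasSum ((innerSL ℂ x).hasSum (E.iUnion S hS hd x))
      have hn : ∀ n, 0 ≤ RCLike.re ⟪x, E.proj (S n) x⟫_ℂ := fun n => by
        have hp := E.isStarProjection (S n) (hS n)
        have h1 : E.proj (S n) x = E.proj (S n) (E.proj (S n) x) := by
          conv_lhs => rw [← hp.isIdempotentElem.eq]
          rfl
        have hsym := (ContinuousLinearMap.isSelfAdjoint_iff_isSymmetric.1 hp.isSelfAdjoint)
        have h2 : ⟪x, E.proj (S n) x⟫_ℂ = ⟪E.proj (S n) x, E.proj (S n) x⟫_ℂ := by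
          rw [h1, ← h1]
          exact (hsym x (E.proj (S n) x)).symm ▸ congrArg _ h1
        rw [h2]
        exact inner_self_nonneg
      rw [← hs.tsum_eq, ENNReal.ofReal_tsum_of_nonneg hn hs.summable])

/-- `B = ∫ f dE`: the domain of `B` is `{x : ∫ |f|² d⟨x, E x⟩ < ∞}`, and
`⟨x, B x⟩ = ∫ f d⟨x, E x⟩` for `x` in the domain (which determines `B`, by polarization). -/
def ResolutionOfIdentity.IsIntegral (E : ResolutionOfIdentity H) (f : ℂ → ℂ)
    (B : H →ₗ.[ℂ] H) : Prop :=
  (∀ x : H, x ∈ B.domain ↔ ∫⁻ z, ‖f z‖ₑ ^ 2 ∂(E.diagMeasure x) < ∞) ∧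
    ∀ x : B.domain, ⟪(x : H), B x⟫_ℂ = ∫ z, f z ∂(E.diagMeasure (x : H))

/-- `B = f(A)` in the measurable functional calculus: `A = ∫ z dE(z)` and `B = ∫ f dE`. -/
def IsFunctionOf (f : ℂ → ℂ) (A B : H →ₗ.[ℂ] H) : Prop :=
  ∃ E : ResolutionOfIdentity H, E.IsIntegral (fun z => z) A ∧ E.IsIntegral f B

open Classical in
/-- The operator `f(A)`. By the spectral theorem it exists and is unique when `A` is normal and
`f` is Borel; where no such operator exists the value is the operator with domain `{0}`. -/
def functionalCalculus (f : ℂ → ℂ) (A : H →ₗ.[ℂ] H) : H →ₗ.[ℂ] H :=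
  if h : ∃ B, IsFunctionOf f A B then h.choose else ⊥

/-- Invertibility of a possibly unbounded operator `A`: there is a bounded everywhere defined `B`
with range `D(A)` such that `A B u = u` for all `u` and `B A v = v` for all `v ∈ D(A)`. -/
def IsInvertibleOperator (A : H →ₗ.[ℂ] H) : Prop :=
  ∃ B : H →L[ℂ] H, LinearMap.range (B : H →ₗ[ℂ] H) = A.domain ∧
    (∀ (u : H) (hu : B u ∈ A.domain), A ⟨B u, hu⟩ = u) ∧ ∀ v : A.domain, B (A v) = v

end FunctionalCalculus

/-! ### Truncated spectral operators -/

/-- `(T₀, T)`-admissible cut-off functions: continuous functions whose range has closure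
`{τ : T₀ ≤ |τ| ≤ T}`. When `T₀ > 0` this set is disconnected, and finitely many points at which
`φ` may jump are disregarded; when `T₀ = 0` there are none. When `c = 1`, the function `φ` is
moreover the restriction of a holomorphic function on a neighbourhood of the real line (less the
disregarded points). Being bounded, a meromorphic `φ` has no poles on the real line. -/
def IsAdmissibleCutoff (c T₀ T : ℝ) (φ : ℝ → ℝ) : Prop :=
  ∃ F : Set ℝ, F.Finite ∧ (T₀ = 0 → F = ∅) ∧ ContinuousOn φ Fᶜ ∧
    closure (φ '' Fᶜ) = {τ : ℝ | T₀ ≤ |τ| ∧ |τ| ≤ T} ∧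
    (c = 1 → ∃ (U : Set ℂ) (g : ℂ → ℂ), IsOpen U ∧ DifferentiableOn ℂ g U ∧
      ∀ x ∈ Fᶜ, (x : ℂ) ∈ U ∧ g x = φ x)

/-- The truncated infinitesimal shift `c + i φ(V_c)`. The spectrum of `V_c` is real, so that
`φ(V_c)` is formed with `z ↦ φ(Re z)`. -/
def truncatedShift (c : ℝ) (φ : ℝ → ℝ) : WeightedL2 c →ₗ.[ℂ] WeightedL2 c :=
  ((c : ℂ) • LinearMap.id (R := ℂ) (M := WeightedL2 c)) +ᵥ
    (Complex.I • functionalCalculus (fun z => (φ z.re : ℂ)) (momentumOperator c))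

/-- The truncated spectral operator `ζ(c + i φ(V_c))`. -/
def truncatedSpectralOperator (c : ℝ) (φ : ℝ → ℝ) : WeightedL2 c →ₗ.[ℂ] WeightedL2 c :=
  functionalCalculus riemannZeta (truncatedShift c φ)

/-- Almost invertibility of the spectral operator `ζ(∂_c)`, tested on all cut-off functions. -/
def AlmostInvertible (c : ℝ) : Prop :=
  ∃ T₀ : ℝ, 0 ≤ T₀ ∧ ∀ T : ℝ, T₀ < T → ∀ φ : ℝ → ℝ, IsAdmissibleCutoff c T₀ T φ →
    IsInvertibleOperator (truncatedSpectralOperator c φ)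

/-- Almost invertibility of the spectral operator `ζ(∂_c)`, tested on one cut-off function
for each `T`. -/
def AlmostInvertibleForSome (c : ℝ) : Prop :=
  ∃ T₀ : ℝ, 0 ≤ T₀ ∧ ∀ T : ℝ, T₀ < T → ∃ φ : ℝ → ℝ, IsAdmissibleCutoff c T₀ T φ ∧
    IsInvertibleOperator (truncatedSpectralOperator c φ)

end

/-! Multiplication by `e^{-ct}` carries `ℍ_c` onto `L²(ℝ)` and `∂_c - c` to `d/dt`; the Fourier
transform then turns `V_c` into multiplication by `2πξ`. Hence the spectral measure of `V_c` is
supported on all of `ℝ` and has no atoms, so the finite exceptional set of a cut-off is negligible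
and the spectral measure of `c + iφ(V_c)` has support exactly `{c + iτ : T₀ ≤ |τ| ≤ T}`. An operator
`∫ f dE` is invertible iff `|f|` is bounded below `E`-almost everywhere
(`IsIntegral.isInvertibleOperator_iff`). On the compact support, away from the pole at `1`,
continuity of `ζ` makes this equivalent to the absence of zeros.

If the zeros on the line are finite in number, any positive `T₀` above all their heights works.
Conversely, a zero of height above `T₀` destroys invertibility when `T` is that height, and a
compact piece of the line carries only finitely many zeros.

The functional calculus is defined by choice, so each operator comes with some unknown resolution of
the identity. Its uniqueness is not needed. `IsIntegral.bounded_below_iff` expresses nullity of `{|f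
- a| < δ}` through the operator alone, so resolutions of the same operator have the same null disks,
hence the same support (`IsIntegral.null_iff`); atoms are compared through eigenvectors
(`IsIntegral.singleton_null`). Both properties are computed for the explicit resolution
`momentumResolution` and transferred to the chosen ones. -/

/-! ### Integration with respect to a resolution of the identity -/

/-- A linear map on a subspace `D` whose quadratic form vanishes has a vanishing sesquilinear
form. -/
theorem Submodule.inner_eq_zero_of_quadratic_eq_zero {H : Type*} [NormedAddCommGroup H]
    [InnerProductSpace ℂ H] {D : Submodule ℂ H} (A : D →ₗ[ℂ] H)
    (hA : ∀ x : D, ⟪(x : H), A x⟫_ℂ = 0) (x y : D) : ⟪(y : H), A x⟫_ℂ = 0 := by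
  have h1 := hA (x + y)
  have h2 := hA (x + Complex.I • y)
  simp only [map_add, map_smul, Submodule.coe_add, Submodule.coe_smul, inner_add_left,
    inner_add_right, inner_smul_left, inner_smul_right, hA, Complex.conj_I] at h1 h2
  have h3 : Complex.I * (⟪(x : H), A y⟫_ℂ - ⟪(y : H), A x⟫_ℂ) = 0 := by
    linear_combination h2
  have h4 : ⟪(x : H), A y⟫_ℂ - ⟪(y : H), A x⟫_ℂ = 0 :=
    (mul_eq_zero.1 h3).resolve_left Complex.I_ne_zero
  linear_combination (h1 - h4) / 2

namespace ResolutionOfIdentity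

open Filter Topology

variable {H : Type*} [NormedAddCommGroup H] [InnerProductSpace ℂ H] [CompleteSpace H]
  (E : ResolutionOfIdentity H)

theorem proj_proj {S T : Set ℂ} (hS : MeasurableSet S) (hT : MeasurableSet T) (x : H) :
    E.proj S (E.proj T x) = E.proj (S ∩ T) x := by
  rw [E.inter S T hS hT]
  rfl

theorem inner_proj_left {S : Set ℂ} (hS : MeasurableSet S) (x y : H) :
    ⟪E.proj S x, y⟫_ℂ = ⟪x, E.proj S y⟫_ℂ :=
  ContinuousLinearMap.isSelfAdjoint_iff_isSymmetric.1 (E.isStarProjection S hS).isSelfAdjoint x y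

theorem inner_proj_proj {S T : Set ℂ} (hS : MeasurableSet S) (hT : MeasurableSet T) (x y : H) :
    ⟪E.proj S x, E.proj T y⟫_ℂ = ⟪x, E.proj (S ∩ T) y⟫_ℂ := by
  rw [E.inner_proj_left hS, E.proj_proj hS hT]

theorem inner_proj_self {S : Set ℂ} (hS : MeasurableSet S) (x : H) :
    ⟪x, E.proj S x⟫_ℂ = ((‖E.proj S x‖ ^ 2 : ℝ) : ℂ) := by
  have h := E.inner_proj_proj hS hS x x
  rw [Set.inter_self, inner_self_eq_norm_sq_to_K] at h
  rw [← h]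
  simp

theorem diagMeasure_apply {S : Set ℂ} (hS : MeasurableSet S) (x : H) :
    E.diagMeasure x S = ENNReal.ofReal (‖E.proj S x‖ ^ 2) := by
  rw [diagMeasure, Measure.ofMeasurable_apply S hS, E.inner_proj_self hS]
  simp only [RCLike.re_to_complex, Complex.ofReal_re]

theorem diagMeasure_univ (x : H) :
    E.diagMeasure x Set.univ = ENNReal.ofReal (‖x‖ ^ 2) := by
  rw [E.diagMeasure_apply MeasurableSet.univ, E.univ, one_apply_eq_self]

instance isFiniteMeasure_diagMeasure (x : H) : IsFiniteMeasure (E.diagMeasure x) :=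
  ⟨by rw [E.diagMeasure_univ]; exact ENNReal.ofReal_lt_top⟩

theorem diagMeasure_real_apply {S : Set ℂ} (hS : MeasurableSet S) (x : H) :
    (E.diagMeasure x).real S = ‖E.proj S x‖ ^ 2 := by
  rw [Measure.real, E.diagMeasure_apply hS, ENNReal.toReal_ofReal (by positivity)]

theorem diagMeasure_real_univ (x : H) : (E.diagMeasure x).real Set.univ = ‖x‖ ^ 2 := by
  rw [E.diagMeasure_real_apply MeasurableSet.univ, E.univ, one_apply_eq_self]

theorem proj_eq_zero_iff {S : Set ℂ} (hS : MeasurableSet S) (x : H) :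
    E.proj S x = 0 ↔ E.diagMeasure x S = 0 := by
  rw [E.diagMeasure_apply hS, ENNReal.ofReal_eq_zero]
  constructor
  · intro h; simp [h]
  · intro h
    have : ‖E.proj S x‖ ^ 2 = 0 := le_antisymm h (by positivity)
    simpa using this

/-- Since `E(T)E(S) = E(T ∩ S)`, projecting a vector localizes its spectral measure. -/
theorem diagMeasure_proj {S : Set ℂ} (hS : MeasurableSet S) (x : H) :
    E.diagMeasure (E.proj S x) = (E.diagMeasure x).restrict S := by
  ext T hT
  rw [Measure.restrict_apply hT, E.diagMeasure_apply hT, E.diagMeasure_apply (hT.inter hS),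
    E.proj_proj hT hS]

/-- From `‖u + v‖² ≤ 2‖u‖² + 2‖v‖²`; this is what makes square integrability define a subspace. -/
theorem diagMeasure_add_le (x y : H) :
    E.diagMeasure (x + y) ≤ (2 : ℝ≥0∞) • (E.diagMeasure x + E.diagMeasure y) := by
  refine Measure.le_iff.2 fun S hS => ?_
  simp only [Measure.smul_apply, Measure.add_apply, smul_eq_mul]
  rw [E.diagMeasure_apply hS, E.diagMeasure_apply hS, E.diagMeasure_apply hS,
    ← ENNReal.ofReal_add (by positivity) (by positivity),
    show (2 : ℝ≥0∞) = ENNReal.ofReal 2 by simp, ← ENNReal.ofReal_mul (by norm_num)]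
  refine ENNReal.ofReal_le_ofReal ?_
  rw [map_add]
  have h := norm_add_le (E.proj S x) (E.proj S y)
  have h0 := norm_nonneg (E.proj S x + E.proj S y)
  nlinarith [sq_nonneg (‖E.proj S x‖ - ‖E.proj S y‖)]

theorem diagMeasure_smul (a : ℂ) (x : H) :
    E.diagMeasure (a • x) = ENNReal.ofReal (‖a‖ ^ 2) • E.diagMeasure x := by
  ext S hS
  rw [Measure.smul_apply, E.diagMeasure_apply hS, E.diagMeasure_apply hS, map_smul, norm_smul,
    mul_pow, ENNReal.ofReal_mul (by positivity), smul_eq_mul]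

theorem diagMeasure_zero : E.diagMeasure 0 = 0 := by
  ext S hS
  rw [E.diagMeasure_apply hS]
  simp

theorem proj_union {S T : Set ℂ} (hS : MeasurableSet S) (hT : MeasurableSet T)
    (hd : Disjoint S T) : E.proj (S ∪ T) = E.proj S + E.proj T := by
  -- Finite additivity is countable additivity for the sequence `S, T, ∅, ∅, …`.
  let A : ℕ → Set ℂ := fun n => if n = 0 then S else if n = 1 then T else ∅
  have hA : ∀ n, MeasurableSet (A n) := by
    intro n
    simp only [A]
    split_ifs
    exacts [hS, hT, MeasurableSet.empty]
  have hAd : Pairwise (Function.onFun Disjoint A) := by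
    intro m n hmn
    simp only [Function.onFun, A]
    split_ifs <;> first | exact hd | exact hd.symm | omega | simp
  have hU : ⋃ n, A n = S ∪ T := by
    ext z
    simp only [Set.mem_iUnion, A, Set.mem_union]
    constructor
    · rintro ⟨n, hn⟩
      split_ifs at hn
      exacts [Or.inl hn, Or.inr hn, hn.elim]
    · rintro (h | h)
      exacts [⟨0, by simpa using h⟩, ⟨1, by simpa using h⟩]
  ext x
  have h1 := E.iUnion A hA hAd x
  have h2 : HasSum (fun n => E.proj (A n) x) (∑ n ∈ Finset.range 2, E.proj (A n) x) := by
    refine hasSum_sum_of_ne_finset_zero fun n hn => ?_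
    have : A n = ∅ := by
      have : 1 < n := by simpa using hn
      simp only [A]
      rw [if_neg (by omega), if_neg (by omega)]
    rw [this, E.empty]
    rfl
  rw [hU] at h1
  have := h1.unique h2
  rw [this, Finset.sum_range_succ, Finset.sum_range_one]
  simp [A]

/-- The set function `S ↦ (z ↦ z • E(S))` used to integrate simple functions. -/
noncomputable def smulProj (S : Set ℂ) : ℂ →L[ℝ] (H →L[ℂ] H) :=
  (ContinuousLinearMap.toSpanSingleton ℂ (E.proj S)).restrictScalars ℝ

theorem smulProj_apply (S : Set ℂ) (z : ℂ) : E.smulProj S z = z • E.proj S := rfl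

/-- Taking the zero measure as reference makes the finiteness conditions in `FinMeasAdditive`
vacuous. -/
theorem finMeasAdditive_smulProj : FinMeasAdditive (0 : Measure ℂ) E.smulProj := by
  intro S T hS hT _ _ hd
  ext z : 1
  rw [add_apply, smulProj_apply, smulProj_apply, smulProj_apply,
    E.proj_union hS hT hd, smul_add]

/-- The integral of a simple function with respect to a resolution of the identity. -/
noncomputable def simpleIntegral (s : SimpleFunc ℂ ℂ) : H →L[ℂ] H :=
  s.setToSimpleFunc E.smulProj

theorem simpleIntegral_apply (s : SimpleFunc ℂ ℂ) (x : H) :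
    E.simpleIntegral s x = ∑ v ∈ s.range, v • E.proj (s ⁻¹' {v}) x := by
  simp only [simpleIntegral, SimpleFunc.setToSimpleFunc, sum_apply,
    smulProj_apply, smul_apply]

theorem simpleIntegral_sub (s t : SimpleFunc ℂ ℂ) :
    E.simpleIntegral (s - t) = E.simpleIntegral s - E.simpleIntegral t :=
  SimpleFunc.setToSimpleFunc_sub _ E.finMeasAdditive_smulProj (by simp) (by simp)

theorem integrable_simpleFunc {F : Type*} [NormedAddCommGroup F] (s : SimpleFunc ℂ F) (x : H) :
    Integrable s (E.diagMeasure x) :=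
  SimpleFunc.integrable_of_isFiniteMeasure s

theorem inner_simpleIntegral_self (s : SimpleFunc ℂ ℂ) (x : H) :
    ⟪x, E.simpleIntegral s x⟫_ℂ = ∫ z, s z ∂(E.diagMeasure x) := by
  rw [SimpleFunc.integral_eq_sum s (E.integrable_simpleFunc s x), simpleIntegral_apply, inner_sum]
  refine Finset.sum_congr rfl fun v _ => ?_
  rw [inner_smul_right, E.inner_proj_self (s.measurableSet_fiber v),
    E.diagMeasure_real_apply (s.measurableSet_fiber v), Complex.real_smul, mul_comm]

/-- Distinct fibres are disjoint, so the cross terms vanish. This isometry is what extends the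
integral from simple to square integrable functions. -/
theorem norm_simpleIntegral_sq (s : SimpleFunc ℂ ℂ) (x : H) :
    ‖E.simpleIntegral s x‖ ^ 2 = ∫ z, ‖s z‖ ^ 2 ∂(E.diagMeasure x) := by
  have h1 : ∫ z, ‖s z‖ ^ 2 ∂(E.diagMeasure x) =
      ∑ v ∈ s.range, (E.diagMeasure x).real (s ⁻¹' {v}) • ‖v‖ ^ 2 := by
    rw [← SimpleFunc.map_integral s (fun v => ‖v‖ ^ 2) (E.integrable_simpleFunc s x) (by simp),
      SimpleFunc.integral_eq_integral _ (E.integrable_simpleFunc _ x)]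
    rfl
  have h2 : (⟪E.simpleIntegral s x, E.simpleIntegral s x⟫_ℂ) =
      ((∑ v ∈ s.range, (E.diagMeasure x).real (s ⁻¹' {v}) • ‖v‖ ^ 2 : ℝ) : ℂ) := by
    rw [simpleIntegral_apply, sum_inner, Complex.ofReal_sum]
    refine Finset.sum_congr rfl fun v hv => ?_
    rw [inner_sum, Finset.sum_eq_single v]
    · rw [inner_smul_left, inner_smul_right, E.inner_proj_proj (s.measurableSet_fiber v)
        (s.measurableSet_fiber v), Set.inter_self, E.inner_proj_self (s.measurableSet_fiber v),
        E.diagMeasure_real_apply (s.measurableSet_fiber v), ← mul_assoc, RCLike.conj_mul]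
      push_cast
      simp [mul_comm]
    · intro w _ hw
      have : s ⁻¹' {v} ∩ s ⁻¹' {w} = ∅ := by
        ext z
        simp only [Set.mem_inter_iff, Set.mem_preimage, Set.mem_singleton_iff,
          Set.mem_empty_iff_false, iff_false, not_and]
        rintro h h'
        exact hw (h' ▸ h)
      rw [inner_smul_left, inner_smul_right, E.inner_proj_proj (s.measurableSet_fiber v)
        (s.measurableSet_fiber w), this, E.empty]
      simp
    · intro h
      exact absurd hv h
  rw [h1, ← Complex.ofReal_inj, ← h2, inner_self_eq_norm_sq_to_K]
  simp

theorem proj_simpleIntegral {S : Set ℂ} (hS : MeasurableSet S) (s : SimpleFunc ℂ ℂ) (x : H) :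
    E.proj S (E.simpleIntegral s x) = E.simpleIntegral s (E.proj S x) := by
  rw [simpleIntegral_apply, simpleIntegral_apply, map_sum]
  refine Finset.sum_congr rfl fun v _ => ?_
  rw [map_smul, E.proj_proj hS (s.measurableSet_fiber v),
    E.proj_proj (s.measurableSet_fiber v) hS, Set.inter_comm]

/-! #### The domain of the integral -/

theorem lintegral_sq_lt_top_iff {f : ℂ → ℂ} (hf : Measurable f) (μ : Measure ℂ) :
    ∫⁻ z, ‖f z‖ₑ ^ 2 ∂μ < ∞ ↔ MemLp f 2 μ := by
  have := eLpNorm_lt_top_iff_lintegral_rpow_enorm_lt_top (f := f) (μ := μ) (p := 2)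
    (by norm_num) (by norm_num)
  simp only [ENNReal.toReal_ofNat, ENNReal.rpow_ofNat] at this
  rw [← this]
  exact ⟨fun h => ⟨hf.aestronglyMeasurable, h⟩, fun h => h.2⟩

/-- The subspace of vectors `x` such that `f` is square integrable for `⟨x, E x⟩`. -/
def integralDomain (f : ℂ → ℂ) : Submodule ℂ H where
  carrier := {x | MemLp f 2 (E.diagMeasure x)}
  zero_mem' := by
    simp [E.diagMeasure_zero]
  add_mem' := by
    intro x y hx hy
    have h1 : MemLp f 2 (E.diagMeasure x + E.diagMeasure y) := by
      refine ⟨hx.1.add_measure hy.1, ?_⟩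
      have h := fun μ : Measure ℂ => eLpNorm_lt_top_iff_lintegral_rpow_enorm_lt_top (f := f)
        (μ := μ) (p := 2) (by norm_num) (by norm_num)
      rw [h, lintegral_add_measure]
      exact ENNReal.add_lt_top.2 ⟨(h _).1 hx.2, (h _).1 hy.2⟩
    exact (h1.smul_measure (by norm_num)).mono_measure (E.diagMeasure_add_le x y)
  smul_mem' := by
    intro a x hx
    simp only [Set.mem_ofPred_eq, E.diagMeasure_smul]
    exact MemLp.smul_measure hx ENNReal.ofReal_ne_top

theorem mem_integralDomain {f : ℂ → ℂ} {x : H} :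
    x ∈ E.integralDomain f ↔ MemLp f 2 (E.diagMeasure x) := Iff.rfl

theorem proj_mem_integralDomain {f : ℂ → ℂ} {x : H} (hx : x ∈ E.integralDomain f) {S : Set ℂ}
    (hS : MeasurableSet S) : E.proj S x ∈ E.integralDomain f := by
  rw [mem_integralDomain, E.diagMeasure_proj hS]
  exact MemLp.restrict S hx

/-- Cutting down to a set where `f` is bounded is the source of domain vectors for an unbounded
integral. -/
theorem proj_mem_integralDomain_of_bound {f : ℂ → ℂ} (hf : Measurable f) {S : Set ℂ}
    (hS : MeasurableSet S) {C : ℝ} (hC : ∀ z ∈ S, ‖f z‖ ≤ C) (x : H) :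
    E.proj S x ∈ E.integralDomain f := by
  rw [mem_integralDomain, E.diagMeasure_proj hS]
  refine MemLp.of_bound hf.aestronglyMeasurable C ?_
  exact (ae_restrict_iff' hS).2 (Eventually.of_forall hC)

/-- The simple functions approximating a Borel function. -/
noncomputable def approx {f : ℂ → ℂ} (hf : Measurable f) (n : ℕ) : SimpleFunc ℂ ℂ :=
  SimpleFunc.approxOn f hf Set.univ 0 (Set.mem_univ _) n

theorem tendsto_approx {f : ℂ → ℂ} (hf : Measurable f) (z : ℂ) :
    Tendsto (fun n => approx hf n z) atTop (𝓝 (f z)) :=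
  SimpleFunc.tendsto_approxOn hf _ (by simp)

theorem norm_approx_le {f : ℂ → ℂ} (hf : Measurable f) (n : ℕ) (z : ℂ) :
    ‖approx hf n z‖ ≤ 2 * ‖f z‖ := by
  have := SimpleFunc.norm_approxOn_zero_le hf (Set.mem_univ 0) z n
  rw [two_mul]
  exact this

theorem integrable_sq {f : ℂ → ℂ} {x : H} (hx : x ∈ E.integralDomain f) :
    Integrable (fun z => ‖f z‖ ^ 2) (E.diagMeasure x) :=
  (memLp_two_iff_integrable_sq_norm hx.1).1 hx

theorem integrable_of_mem {f : ℂ → ℂ} {x : H} (hx : x ∈ E.integralDomain f) :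
    Integrable f (E.diagMeasure x) :=
  MemLp.integrable one_le_two hx

theorem tendsto_integral_approx_sub_sq {f : ℂ → ℂ} (hf : Measurable f) {x : H}
    (hx : x ∈ E.integralDomain f) :
    Tendsto (fun n => ∫ z, ‖approx hf n z - f z‖ ^ 2 ∂(E.diagMeasure x)) atTop (𝓝 0) := by
  have : Tendsto (fun n => ∫ z, ‖approx hf n z - f z‖ ^ 2 ∂(E.diagMeasure x)) atTop
      (𝓝 (∫ _, (0 : ℝ) ∂(E.diagMeasure x))) := by
    refine tendsto_integral_of_dominated_convergence (fun z => 9 * ‖f z‖ ^ 2) ?_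
      ((E.integrable_sq hx).const_mul 9) ?_ ?_
    · intro n
      exact (((approx hf n).measurable.sub hf).norm.pow_const 2).aestronglyMeasurable
    · intro n
      refine Eventually.of_forall fun z => ?_
      rw [Real.norm_of_nonneg (by positivity)]
      have h1 := norm_sub_le (approx hf n z) (f z)
      have h2 := norm_approx_le hf n z
      have h3 : ‖approx hf n z - f z‖ ≤ 3 * ‖f z‖ := by linarith
      calc ‖approx hf n z - f z‖ ^ 2 ≤ (3 * ‖f z‖) ^ 2 := by gcongr
        _ = 9 * ‖f z‖ ^ 2 := by ring
    · refine Eventually.of_forall fun z => ?_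
      have := ((tendsto_approx hf z).sub_const (f z)).norm.pow 2
      simpa using this
  simpa using this

theorem cauchySeq_simpleIntegral_approx {f : ℂ → ℂ} (hf : Measurable f) {x : H}
    (hx : x ∈ E.integralDomain f) :
    CauchySeq fun n => E.simpleIntegral (approx hf n) x := by
  set a : ℕ → ℝ := fun n => ∫ z, ‖approx hf n z - f z‖ ^ 2 ∂(E.diagMeasure x) with ha
  have hint : ∀ n, Integrable (fun z => ‖approx hf n z - f z‖ ^ 2) (E.diagMeasure x) := by
    intro n
    refine (memLp_two_iff_integrable_sq_norm
      ((approx hf n).measurable.sub hf).aestronglyMeasurable).1 ?_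
    exact (SimpleFunc.memLp_of_isFiniteMeasure (approx hf n) 2 _).sub hx
  -- The isometry turns the left side into an `L²` distance of approximants, which is compared with
  -- `f`.
  have key : ∀ m n, ‖E.simpleIntegral (approx hf m) x - E.simpleIntegral (approx hf n) x‖ ^ 2 ≤
      2 * a m + 2 * a n := by
    intro m n
    rw [← sub_apply, ← E.simpleIntegral_sub, E.norm_simpleIntegral_sq, ha,
      ← integral_const_mul, ← integral_const_mul,
      ← integral_add ((hint m).const_mul 2) ((hint n).const_mul 2)]
    refine integral_mono ?_ (((hint m).const_mul 2).add ((hint n).const_mul 2)) fun z => ?_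
    · exact (memLp_two_iff_integrable_sq_norm
        (SimpleFunc.measurable _).aestronglyMeasurable).1 (SimpleFunc.memLp_of_isFiniteMeasure _ 2 _)
    · have h := norm_sub_le (approx hf m z - f z) (approx hf n z - f z)
      rw [sub_sub_sub_cancel_right] at h
      have h' : ‖(approx hf m - approx hf n) z‖ = ‖approx hf m z - approx hf n z‖ := rfl
      simp only [h']
      nlinarith [norm_nonneg (approx hf m z - approx hf n z),
        sq_nonneg (‖approx hf m z - f z‖ - ‖approx hf n z - f z‖)]
  rw [Metric.cauchySeq_iff]
  intro ε hε
  have h0 := (E.tendsto_integral_approx_sub_sq hf hx).eventually (gt_mem_nhds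
    (show (0 : ℝ) < ε ^ 2 / 4 by positivity))
  obtain ⟨N, hN⟩ := eventually_atTop.1 h0
  refine ⟨N, fun m hm n hn => ?_⟩
  rw [dist_eq_norm]
  have h1 := key m n
  have h2 := hN m hm
  have h3 := hN n hn
  refine lt_of_pow_lt_pow_left₀ 2 hε.le ?_
  linarith

/-- The value of `∫ f dE` at a vector. -/
noncomputable def integralApply {f : ℂ → ℂ} (hf : Measurable f) (x : H) : H :=
  limUnder atTop fun n => E.simpleIntegral (approx hf n) x

theorem tendsto_integralApply {f : ℂ → ℂ} (hf : Measurable f) {x : H}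
    (hx : x ∈ E.integralDomain f) :
    Tendsto (fun n => E.simpleIntegral (approx hf n) x) atTop (𝓝 (E.integralApply hf x)) :=
  (E.cauchySeq_simpleIntegral_approx hf hx).tendsto_limUnder

/-- The operator `∫ f dE`. -/
noncomputable def integral {f : ℂ → ℂ} (hf : Measurable f) : H →ₗ.[ℂ] H where
  domain := E.integralDomain f
  toFun :=
    { toFun := fun x => E.integralApply hf x
      map_add' := by
        intro x y
        refine tendsto_nhds_unique (E.tendsto_integralApply hf (x + y).2) ?_
        simp only [Submodule.coe_add, map_add]
        exact (E.tendsto_integralApply hf x.2).add (E.tendsto_integralApply hf y.2)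
      map_smul' := by
        intro a x
        refine tendsto_nhds_unique (E.tendsto_integralApply hf (a • x).2) ?_
        simp only [Submodule.coe_smul, map_smul]
        exact (E.tendsto_integralApply hf x.2).const_smul a }

theorem inner_integralApply {f : ℂ → ℂ} (hf : Measurable f) {x : H}
    (hx : x ∈ E.integralDomain f) :
    ⟪x, E.integralApply hf x⟫_ℂ = ∫ z, f z ∂(E.diagMeasure x) := by
  have h1 := (tendsto_const_nhds (x := x)).inner (𝕜 := ℂ) (E.tendsto_integralApply hf hx)
  refine tendsto_nhds_unique h1 ?_
  simp only [E.inner_simpleIntegral_self]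
  refine tendsto_integral_of_dominated_convergence (fun z => 2 * ‖f z‖) ?_
    ((E.integrable_of_mem hx).norm.const_mul 2) ?_ ?_
  · exact fun n => (approx hf n).measurable.aestronglyMeasurable
  · exact fun n => Eventually.of_forall (norm_approx_le hf n)
  · exact Eventually.of_forall (tendsto_approx hf)

theorem norm_integralApply_sq {f : ℂ → ℂ} (hf : Measurable f) {x : H}
    (hx : x ∈ E.integralDomain f) :
    ‖E.integralApply hf x‖ ^ 2 = ∫ z, ‖f z‖ ^ 2 ∂(E.diagMeasure x) := by
  refine tendsto_nhds_unique ((E.tendsto_integralApply hf hx).norm.pow 2) ?_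
  simp only [E.norm_simpleIntegral_sq]
  refine tendsto_integral_of_dominated_convergence (fun z => 4 * ‖f z‖ ^ 2) ?_
    ((E.integrable_sq hx).const_mul 4) ?_ ?_
  · exact fun n => ((approx hf n).measurable.norm.pow_const 2).aestronglyMeasurable
  · refine fun n => Eventually.of_forall fun z => ?_
    rw [Real.norm_of_nonneg (by positivity)]
    calc ‖approx hf n z‖ ^ 2 ≤ (2 * ‖f z‖) ^ 2 := by
          gcongr
          exact norm_approx_le hf n z
      _ = 4 * ‖f z‖ ^ 2 := by ring
  · exact Eventually.of_forall fun z => (tendsto_approx hf z).norm.pow 2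

theorem proj_integralApply {f : ℂ → ℂ} (hf : Measurable f) {x : H}
    (hx : x ∈ E.integralDomain f) {S : Set ℂ} (hS : MeasurableSet S) :
    E.proj S (E.integralApply hf x) = E.integralApply hf (E.proj S x) := by
  have h1 := ((E.proj S).continuous.tendsto _).comp (E.tendsto_integralApply hf hx)
  refine tendsto_nhds_unique h1 ?_
  simp only [Function.comp_def, E.proj_simpleIntegral hS]
  exact E.tendsto_integralApply hf (E.proj_mem_integralDomain hx hS)

theorem isIntegral_integral {f : ℂ → ℂ} (hf : Measurable f) :
    E.IsIntegral f (E.integral hf) :=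
  ⟨fun _ => (lintegral_sq_lt_top_iff hf _).symm, fun x => E.inner_integralApply hf x.2⟩

/-- The domain contains every `E(|f| ≤ n) w`; testing against these shows that the spectral measure
of `w` vanishes on sets exhausting `ℂ`. -/
theorem eq_zero_of_forall_inner_eq_zero {f : ℂ → ℂ} (hf : Measurable f) {w : H}
    (hw : ∀ y ∈ E.integralDomain f, ⟪y, w⟫_ℂ = 0) : w = 0 := by
  let S : ℕ → Set ℂ := fun n => {z | ‖f z‖ ≤ n}
  have hS : ∀ n, MeasurableSet (S n) := fun n => measurableSet_le hf.norm measurable_const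
  have h0 : ∀ n, E.diagMeasure w (S n) = 0 := by
    intro n
    have h := hw _ (E.proj_mem_integralDomain_of_bound hf (hS n) (fun z hz => hz) w)
    rw [E.inner_proj_left (hS n), E.inner_proj_self (hS n), Complex.ofReal_eq_zero] at h
    rw [E.diagMeasure_apply (hS n), h, ENNReal.ofReal_zero]
  have hU : ⋃ n, S n = Set.univ :=
    Set.eq_univ_of_forall fun z => Set.mem_iUnion.2 (exists_nat_ge ‖f z‖)
  have h1 : E.diagMeasure w Set.univ = 0 := by
    rw [← hU]
    exact measure_iUnion_null h0
  rw [← E.proj_eq_zero_iff MeasurableSet.univ, E.univ] at h1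
  exact h1

variable {E}

theorem IsIntegral.domain_eq {f : ℂ → ℂ} (hf : Measurable f) {B : H →ₗ.[ℂ] H}
    (hB : E.IsIntegral f B) : B.domain = E.integralDomain f := by
  ext x
  rw [hB.1 x, lintegral_sq_lt_top_iff hf, mem_integralDomain]

/-- The quadratic form determines the operator, by polarization and density of the domain. Hence
every `B` with `IsIntegral` inherits the properties of the constructed integral. -/
theorem IsIntegral.eq_integral {f : ℂ → ℂ} (hf : Measurable f) {B : H →ₗ.[ℂ] H}
    (hB : E.IsIntegral f B) : B = E.integral hf := by
  have hdom := hB.domain_eq hf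
  obtain ⟨D, B⟩ := B
  dsimp only at hdom
  subst hdom
  have key : ∀ x : E.integralDomain f, B x = E.integralApply hf (x : H) := by
    intro x
    have hz := Submodule.inner_eq_zero_of_quadratic_eq_zero
      (B - (show E.integralDomain f →ₗ[ℂ] H from (E.integral hf).toFun)) (fun y => by
      rw [LinearMap.sub_apply, inner_sub_right, sub_eq_zero]
      exact (hB.2 y).trans (E.inner_integralApply hf y.2).symm) x
    exact sub_eq_zero.1 (E.eq_zero_of_forall_inner_eq_zero hf fun y hy => hz ⟨y, hy⟩)
  congr 1
  exact LinearMap.ext key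

theorem IsIntegral.norm_sq {f : ℂ → ℂ} (hf : Measurable f) {B : H →ₗ.[ℂ] H}
    (hB : E.IsIntegral f B) (x : B.domain) :
    ‖B x‖ ^ 2 = ∫ z, ‖f z‖ ^ 2 ∂(E.diagMeasure (x : H)) := by
  obtain rfl := hB.eq_integral hf
  exact E.norm_integralApply_sq hf x.2

/-- Expanding both squares reduces this to the norm formula and the quadratic form of `B`, so `B -
a` never has to be treated as a separate operator. -/
theorem IsIntegral.norm_sub_smul_sq {f : ℂ → ℂ} (hf : Measurable f) {B : H →ₗ.[ℂ] H}
    (hB : E.IsIntegral f B) (a : ℂ) (x : B.domain) :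
    ‖B x - a • (x : H)‖ ^ 2 = ∫ z, ‖f z - a‖ ^ 2 ∂(E.diagMeasure (x : H)) := by
  have hx : (x : H) ∈ E.integralDomain f := hB.domain_eq hf ▸ x.2
  have h1 : ∀ z, ‖f z - a‖ ^ 2 =
      ‖f z‖ ^ 2 - 2 * (starRingEnd ℂ a * f z).re + ‖a‖ ^ 2 := by
    intro z
    rw [← Complex.normSq_eq_norm_sq, ← Complex.normSq_eq_norm_sq, ← Complex.normSq_eq_norm_sq,
      Complex.normSq_sub, mul_comm (f z)]
    ring
  have hi : Integrable (fun z => starRingEnd ℂ a * f z) (E.diagMeasure (x : H)) :=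
    (E.integrable_of_mem hx).const_mul _
  have hre : Integrable (fun z => (starRingEnd ℂ a * f z).re) (E.diagMeasure (x : H)) := hi.re
  simp only [h1]
  rw [integral_add, integral_sub (E.integrable_sq hx) (hre.const_mul 2), integral_const_mul]
  · have h2 : ∫ z, (starRingEnd ℂ a * f z).re ∂(E.diagMeasure (x : H)) =
        (starRingEnd ℂ a * ⟪(x : H), B x⟫_ℂ).re := by
      rw [hB.2 x, ← integral_const_mul]
      exact integral_re hi
    rw [h2, ← hB.norm_sq hf, integral_const, E.diagMeasure_real_univ, norm_sub_sq (𝕜 := ℂ),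
      inner_smul_right, norm_smul, smul_eq_mul, ← inner_conj_symm, RCLike.re_to_complex,
      ← Complex.conj_re, map_mul, Complex.conj_conj]
    ring
  · exact (E.integrable_sq hx).sub (hre.const_mul 2)
  · exact integrable_const _

/-- `∫ f dE - a` is bounded below by `δ` if and only if `E` vanishes on `{|f - a| < δ}`. -/
theorem IsIntegral.bounded_below_iff {f : ℂ → ℂ} (hf : Measurable f) {B : H →ₗ.[ℂ] H}
    (hB : E.IsIntegral f B) (a : ℂ) {δ : ℝ} (hδ : 0 ≤ δ) :
    (∀ x : B.domain, δ * ‖(x : H)‖ ≤ ‖B x - a • (x : H)‖) ↔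
      ∀ x : H, E.diagMeasure x {z | ‖f z - a‖ < δ} = 0 := by
  have hS : MeasurableSet {z | ‖f z - a‖ < δ} :=
    measurableSet_lt (hf.sub_const a).norm measurable_const
  constructor
  · intro h x
    -- The lower bound is tested on the projected vector, whose spectral measure lives on the set in
    -- question.
    have hD : E.proj {z | ‖f z - a‖ < δ} x ∈ B.domain := by
      rw [hB.domain_eq hf]
      refine E.proj_mem_integralDomain_of_bound hf hS (C := ‖a‖ + δ) (fun z hz => ?_) x
      have hz' : ‖f z - a‖ < δ := hz
      have := norm_add_le a (f z - a)
      rw [add_sub_cancel] at this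
      linarith
    have h1 := h ⟨_, hD⟩
    have h2 : δ ^ 2 * ‖E.proj {z | ‖f z - a‖ < δ} x‖ ^ 2 ≤
        ∫ z in {z | ‖f z - a‖ < δ}, ‖f z - a‖ ^ 2 ∂(E.diagMeasure x) := by
      rw [← E.diagMeasure_proj hS, ← hB.norm_sub_smul_sq hf a ⟨_, hD⟩, ← mul_pow]
      exact pow_le_pow_left₀ (by positivity) h1 2
    have hint : Integrable (fun z => ‖f z - a‖ ^ 2)
        ((E.diagMeasure x).restrict {z | ‖f z - a‖ < δ}) := by
      refine Integrable.of_bound ((hf.sub_const a).norm.pow_const 2).aestronglyMeasurable (δ ^ 2) ?_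
      refine (ae_restrict_iff' hS).2 (Eventually.of_forall fun z hz => ?_)
      rw [Real.norm_of_nonneg (by positivity)]
      exact pow_le_pow_left₀ (norm_nonneg _) (le_of_lt hz) 2
    -- The integrand is strictly positive on the set, so a nonpositive integral forces the set to be
    -- null.
    have h3 : ∫ z in {z | ‖f z - a‖ < δ}, (δ ^ 2 - ‖f z - a‖ ^ 2) ∂(E.diagMeasure x) ≤ 0 := by
      rw [integral_sub (integrable_const _) hint, integral_const, measureReal_restrict_apply_univ,
        E.diagMeasure_real_apply hS, smul_eq_mul]
      linarith
    by_contra hne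
    have h4 : 0 < ∫ z in {z | ‖f z - a‖ < δ}, (δ ^ 2 - ‖f z - a‖ ^ 2) ∂(E.diagMeasure x) := by
      rw [setIntegral_pos_iff_support_of_nonneg_ae]
      · refine (pos_iff_ne_zero.2 hne).trans_le (measure_mono fun z hz => ⟨?_, hz⟩)
        have hz' : ‖f z - a‖ < δ := hz
        rw [Function.mem_support]
        have := pow_lt_pow_left₀ hz' (norm_nonneg _) two_ne_zero
        linarith
      · refine (ae_restrict_iff' hS).2 (Eventually.of_forall fun z hz => ?_)
        have hz' : ‖f z - a‖ < δ := hz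
        have := pow_lt_pow_left₀ hz' (norm_nonneg _) two_ne_zero
        simp only [Pi.zero_apply]
        linarith
      · exact (integrable_const _).sub hint
    linarith
  · intro h x
    have hx : (x : H) ∈ E.integralDomain f := hB.domain_eq hf ▸ x.2
    refine le_of_sq_le_sq ?_ (norm_nonneg _)
    rw [hB.norm_sub_smul_sq hf, mul_pow, ← E.diagMeasure_real_univ, mul_comm, ← smul_eq_mul,
      ← integral_const]
    refine integral_mono_ae (integrable_const _) ?_ ?_
    · exact (memLp_two_iff_integrable_sq_norm (hf.sub_const a).aestronglyMeasurable).1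
        (MemLp.sub hx (memLp_const a))
    · have : ∀ᵐ z ∂(E.diagMeasure (x : H)), ¬ ‖f z - a‖ < δ := by
        rw [ae_iff]
        simpa using h x
      filter_upwards [this] with z hz
      exact pow_le_pow_left₀ hδ (not_lt.1 hz) 2

end ResolutionOfIdentity

namespace ResolutionOfIdentity

open Filter Topology

variable {H : Type*} [NormedAddCommGroup H] [InnerProductSpace ℂ H] [CompleteSpace H]
  (E : ResolutionOfIdentity H)

/-! #### Products and inverses -/

/-- `E(S)` commutes with `∫ g dE`, so the norm formula applies on each `S`. This decides when `(∫ g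
dE) y` lies in the domain of another integral. -/
theorem diagMeasure_integralApply {g : ℂ → ℂ} (hg : Measurable g) {y : H}
    (hy : y ∈ E.integralDomain g) :
    E.diagMeasure (E.integralApply hg y) =
      (E.diagMeasure y).withDensity fun z => ‖g z‖ₑ ^ 2 := by
  ext S hS
  have hyS := E.proj_mem_integralDomain hy hS
  have hint := E.integrable_sq hyS
  rw [E.diagMeasure_apply hS, E.proj_integralApply hg hy hS, E.norm_integralApply_sq hg hyS,
    withDensity_apply _ hS, ← E.diagMeasure_proj hS,
    ofReal_integral_eq_lintegral_ofReal hint (Eventually.of_forall fun z => by positivity)]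
  refine lintegral_congr fun z => ?_
  rw [ENNReal.ofReal_pow (norm_nonneg _), ofReal_norm]

/-- Multiplicativity of the calculus in weak form, with one factor simple; the general factor is
reached as a limit. -/
theorem inner_simpleIntegral_integralApply {g : ℂ → ℂ} (hg : Measurable g) {y : H}
    (hy : y ∈ E.integralDomain g) (s : SimpleFunc ℂ ℂ) :
    ⟪y, E.simpleIntegral s (E.integralApply hg y)⟫_ℂ = ∫ z, s z * g z ∂(E.diagMeasure y) := by
  have h1 : ∀ z, s z * g z =
      ∑ v ∈ s.range, (s ⁻¹' {v}).indicator (fun z => v * g z) z := by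
    intro z
    rw [Finset.sum_eq_single (s z)]
    · simp
    · intro v _ hv
      have hz : z ∉ s ⁻¹' {v} := fun h => hv (Set.mem_singleton_iff.1 h).symm
      exact Set.indicator_of_notMem hz _
    · exact fun h => absurd (SimpleFunc.mem_range_self s z) h
  have hig := E.integrable_of_mem hy
  simp only [h1]
  rw [integral_finsetSum _ fun v _ => (hig.const_mul v).indicator (s.measurableSet_fiber v),
    simpleIntegral_apply, inner_sum]
  refine Finset.sum_congr rfl fun v _ => ?_
  have hv := s.measurableSet_fiber v
  rw [integral_indicator hv, integral_const_mul, inner_smul_right, ← E.diagMeasure_proj hv,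
    ← E.inner_integralApply hg (E.proj_mem_integralDomain hy hv), ← E.proj_integralApply hg hy hv,
    E.inner_proj_proj hv hv, Set.inter_self]

variable {E}

/-- A bounded inverse bounds `B` below, which is a null-set condition by `bounded_below_iff`.
Conversely, the inverse is `∫ f⁻¹ dE`. -/
theorem IsIntegral.isInvertibleOperator_iff {f : ℂ → ℂ} (hf : Measurable f) {B : H →ₗ.[ℂ] H}
    (hB : E.IsIntegral f B) :
    IsInvertibleOperator B ↔ ∃ ε > 0, ∀ x : H, E.diagMeasure x {z | ‖f z‖ < ε} = 0 := by
  constructor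
  · rintro ⟨G, -, -, hG⟩
    -- The added `1` covers `G = 0`, possible on the zero space.
    refine ⟨(‖G‖ + 1)⁻¹, by positivity, ?_⟩
    have h := (hB.bounded_below_iff hf 0 (δ := (‖G‖ + 1)⁻¹) (by positivity)).1 (fun v => by
      rw [zero_smul, sub_zero, inv_mul_le_iff₀ (by positivity)]
      calc ‖(v : H)‖ = ‖G (B v)‖ := by rw [hG v]
        _ ≤ ‖G‖ * ‖B v‖ := G.le_opNorm _
        _ ≤ (‖G‖ + 1) * ‖B v‖ := by gcongr; linarith)
    simpa using h
  · rintro ⟨ε, hε, hnull⟩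
    have hlow : ∀ v : B.domain, ε * ‖(v : H)‖ ≤ ‖B v‖ := by
      have := (hB.bounded_below_iff hf 0 hε.le).2 (by simpa using hnull)
      simpa using this
    -- Replacing `f⁻¹` by zero on the null set makes `g` bounded everywhere.
    let g : ℂ → ℂ := fun z => if ‖f z‖ < ε then 0 else (f z)⁻¹
    have hS : MeasurableSet {z | ‖f z‖ < ε} := measurableSet_lt hf.norm measurable_const
    have hg : Measurable g := Measurable.ite hS measurable_const hf.inv
    have hgb : ∀ z, ‖g z‖ ≤ ε⁻¹ := by
      intro z
      simp only [g]
      split_ifs with h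
      · simpa using hε.le
      · rw [norm_inv]
        exact inv_anti₀ hε (not_lt.1 h)
    have hfgb : ∀ z, ‖f z * g z‖ ≤ 1 := by
      intro z
      simp only [g]
      split_ifs with h
      · simp
      · rw [mul_inv_cancel₀ (norm_pos_iff.1 (hε.trans_le (not_lt.1 h))), norm_one]
    have hfg : ∀ x : H, ∀ᵐ z ∂(E.diagMeasure x), f z * g z = 1 := by
      intro x
      have : ∀ᵐ z ∂(E.diagMeasure x), ¬ ‖f z‖ < ε := by
        rw [ae_iff]
        simpa using hnull x
      filter_upwards [this] with z hz
      simp only [g, if_neg hz]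
      exact mul_inv_cancel₀ (norm_pos_iff.1 (hε.trans_le (not_lt.1 hz)))
    have hgD : ∀ y : H, y ∈ E.integralDomain g := fun y =>
      MemLp.of_bound hg.aestronglyMeasurable ε⁻¹ (Eventually.of_forall hgb)
    let G₀ : H →ₗ[ℂ] H := (E.integral hg).toFun.comp
      (LinearMap.codRestrict (E.integralDomain g) LinearMap.id hgD)
    have hG₀ : ∀ y, G₀ y = E.integralApply hg y := fun y => rfl
    let G : H →L[ℂ] H := G₀.mkContinuous ε⁻¹ (by
      intro y
      refine le_of_sq_le_sq ?_ (by positivity)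
      rw [hG₀, E.norm_integralApply_sq hg (hgD y), mul_pow, ← E.diagMeasure_real_univ, mul_comm,
        ← smul_eq_mul, ← integral_const]
      exact integral_mono (E.integrable_sq (hgD y)) (integrable_const _)
        fun z => pow_le_pow_left₀ (norm_nonneg _) (hgb z) 2)
    have hG : ∀ y, G y = E.integralApply hg y := fun y => rfl
    have hGD : ∀ y, G y ∈ B.domain := by
      intro y
      rw [hB.1, hG, E.diagMeasure_integralApply hg (hgD y),
        lintegral_withDensity_eq_lintegral_mul _ (hg.enorm.pow_const 2) (hf.enorm.pow_const 2)]
      calc _ ≤ ∫⁻ _, 1 ∂(E.diagMeasure y) := by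
            refine lintegral_mono fun z => ?_
            have h := hfgb z
            have h' : ‖f z * g z‖ₑ ≤ 1 := by
              rw [← ofReal_norm]
              exact ENNReal.ofReal_le_one.2 h
            calc ‖g z‖ₑ ^ 2 * ‖f z‖ₑ ^ 2 = ‖f z * g z‖ₑ ^ 2 := by rw [enorm_mul]; ring
              _ ≤ 1 ^ 2 := by gcongr
              _ = 1 := one_pow 2
        _ < ∞ := by
            rw [lintegral_one]
            exact measure_lt_top _ _
    let A : H →ₗ[ℂ] H := B.toFun.comp (LinearMap.codRestrict B.domain G.toLinearMap hGD)
    have hA : ∀ y, A y = E.integralApply hf (G y) := by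
      intro y
      obtain rfl := hB.eq_integral hf
      rfl
    -- Over `ℂ` it suffices to compare quadratic forms; `⟪y, B G y⟫` is the limit of `∫ sₙ g` with
    -- `sₙ → f`, and `f g = 1` almost everywhere.
    have hA1 : A = LinearMap.id := by
      rw [← sub_eq_zero, ← inner_map_self_eq_zero]
      intro y
      rw [LinearMap.sub_apply, inner_sub_left, sub_eq_zero, LinearMap.id_apply]
      have h1 : ⟪y, A y⟫_ℂ = ⟪y, y⟫_ℂ := by
        have hGy : G y ∈ E.integralDomain f := hB.domain_eq hf ▸ hGD y
        have hl := (tendsto_const_nhds (x := y)).inner (𝕜 := ℂ) (E.tendsto_integralApply hf hGy)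
        rw [hA]
        refine tendsto_nhds_unique hl ?_
        have hr : ⟪y, y⟫_ℂ = ∫ z, f z * g z ∂(E.diagMeasure y) := by
          rw [integral_congr_ae (hfg y), integral_const, E.diagMeasure_real_univ,
            inner_self_eq_norm_sq_to_K]
          simp
        rw [hr]
        simp only [hG, E.inner_simpleIntegral_integralApply hg (hgD y)]
        refine tendsto_integral_of_dominated_convergence (fun _ => 2) ?_ (integrable_const _) ?_ ?_
        · exact fun n => ((approx hf n).measurable.mul hg).aestronglyMeasurable
        · refine fun n => Eventually.of_forall fun z => ?_
          rw [norm_mul]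
          calc _ ≤ 2 * ‖f z‖ * ‖g z‖ := by
                gcongr
                exact norm_approx_le hf n z
            _ = 2 * ‖f z * g z‖ := by rw [norm_mul]; ring
            _ ≤ 2 := by linarith [hfgb z]
        · exact Eventually.of_forall fun z => (tendsto_approx hf z).mul_const _
      rw [← inner_conj_symm, h1, inner_conj_symm]
    have hBG : ∀ (u : H) (hu : G u ∈ B.domain), B ⟨G u, hu⟩ = u := fun u _ =>
      LinearMap.congr_fun hA1 u
    -- `B` sends `G (B v) - v` to zero, and the lower bound makes `B` injective.
    have hGB : ∀ v : B.domain, G (B v) = v := by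
      intro v
      have h1 := hBG (B v) (hGD _)
      have h2 := hlow (⟨G (B v), hGD _⟩ - v)
      rw [LinearPMap.map_sub, h1, sub_self, norm_zero] at h2
      have h3 : ‖((⟨G (B v), hGD _⟩ - v : B.domain) : H)‖ = 0 :=
        le_antisymm (by nlinarith [norm_nonneg ((⟨G (B v), hGD _⟩ - v : B.domain) : H)])
          (norm_nonneg _)
      exact sub_eq_zero.1 (norm_eq_zero.1 h3)
    refine ⟨G, le_antisymm ?_ fun v hv => ⟨B ⟨v, hv⟩, hGB ⟨v, hv⟩⟩, hBG, hGB⟩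
    rintro _ ⟨y, rfl⟩
    exact hGD y

/-! #### Change of variables -/

variable (E)

/-- The image of a resolution of the identity under a Borel map. -/
def map {h : ℂ → ℂ} (hh : Measurable h) : ResolutionOfIdentity H where
  proj S := E.proj (h ⁻¹' S)
  isStarProjection S hS := E.isStarProjection _ (hh hS)
  empty := by rw [Set.preimage_empty, E.empty]
  univ := by rw [Set.preimage_univ, E.univ]
  inter S S' hS hS' := by rw [Set.preimage_inter, E.inter _ _ (hh hS) (hh hS')]
  iUnion S hS hd x := by
    rw [Set.preimage_iUnion]
    exact E.iUnion _ (fun n => hh (hS n)) (fun m n hmn => (hd hmn).preimage h) x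

theorem diagMeasure_map {h : ℂ → ℂ} (hh : Measurable h) (x : H) :
    (E.map hh).diagMeasure x = (E.diagMeasure x).map h := by
  ext S hS
  rw [Measure.map_apply hh hS, diagMeasure_apply _ hS, diagMeasure_apply _ (hh hS)]
  rfl

variable {E}

theorem IsIntegral.map {f h : ℂ → ℂ} (hf : Measurable f) (hh : Measurable h) {B : H →ₗ.[ℂ] H}
    (hB : E.IsIntegral (fun z => f (h z)) B) : (E.map hh).IsIntegral f B := by
  refine ⟨fun x => ?_, fun x => ?_⟩
  · rw [hB.1, diagMeasure_map, lintegral_map (hf.enorm.pow_const 2) hh]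
  · rw [hB.2, diagMeasure_map, integral_map hh.aemeasurable hf.aestronglyMeasurable]

/-- The condition `b ≠ 0` matters for the domain: for `b = 0` the function is constant and its
integral is everywhere defined, while the operator keeps the domain of `B`. -/
theorem IsIntegral.affine {f : ℂ → ℂ} (hf : Measurable f) {B : H →ₗ.[ℂ] H}
    (hB : E.IsIntegral f B) (a : ℂ) {b : ℂ} (hb : b ≠ 0) :
    E.IsIntegral (fun z => a + b * f z)
      ((a • LinearMap.id (R := ℂ) (M := H)) +ᵥ (b • B)) := by
  have hf' : Measurable fun z => a + b * f z := (hf.const_mul b).const_add a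
  refine ⟨fun x => ?_, fun x => ?_⟩
  · rw [LinearPMap.vadd_domain, LinearPMap.smul_domain, hB.1, lintegral_sq_lt_top_iff hf,
      lintegral_sq_lt_top_iff hf']
    constructor
    · exact fun h => (memLp_const a).add (h.const_mul b)
    · intro h
      have h2 := (h.sub (memLp_const a)).const_mul b⁻¹
      refine h2.congr_norm hf.aestronglyMeasurable (Eventually.of_forall fun z => ?_)
      simp [hb]
  · have hx : (x : H) ∈ E.integralDomain f := hB.domain_eq hf ▸ x.2
    rw [LinearPMap.vadd_apply, LinearPMap.smul_apply, inner_add_right, inner_smul_right,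
      integral_add (integrable_const a) ((E.integrable_of_mem hx).const_mul b), integral_const,
      integral_const_mul, E.diagMeasure_real_univ, LinearMap.smul_apply, LinearMap.id_apply,
      inner_smul_right, inner_self_eq_norm_sq_to_K]
    congr 1
    · simp [mul_comm]
    · congr 1
      exact hB.2 x

/-! #### Comparison of two resolutions of the identity -/

/-- Two functional calculi yielding the same operator have the same null disks. -/
theorem IsIntegral.null_iff {E' : ResolutionOfIdentity H} {f f' : ℂ → ℂ} (hf : Measurable f)
    (hf' : Measurable f') {A : H →ₗ.[ℂ] H} (hE : E.IsIntegral f A) (hE' : E'.IsIntegral f' A)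
    (a : ℂ) {δ : ℝ} (hδ : 0 ≤ δ) :
    (∀ x, E.diagMeasure x {z | ‖f z - a‖ < δ} = 0) ↔
      ∀ x, E'.diagMeasure x {z | ‖f' z - a‖ < δ} = 0 := by
  rw [← hE.bounded_below_iff hf a hδ, hE'.bounded_below_iff hf' a hδ]

/-- Two resolutions of the identity of the same operator have the same atoms. -/
theorem IsIntegral.singleton_null {E' : ResolutionOfIdentity H} {A : H →ₗ.[ℂ] H}
    (hE : E.IsIntegral (fun z => z) A) (hE' : E'.IsIntegral (fun z => z) A) {a : ℂ}
    (h : ∀ x, E.diagMeasure x {a} = 0) (x : H) : E'.diagMeasure x {a} = 0 := by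
  have ha : MeasurableSet {a} := measurableSet_singleton a
  rw [← E'.proj_eq_zero_iff ha]
  set y := E'.proj {a} x with hy
  have hyD : y ∈ A.domain := by
    rw [hE'.domain_eq measurable_id']
    refine E'.proj_mem_integralDomain_of_bound measurable_id' ha (C := ‖a‖) (fun z hz => ?_) x
    rw [Set.mem_singleton_iff.1 hz]
  -- `y` satisfies `A y = a y`. Read through `E`, its spectral measure is concentrated at `a`, which
  -- is `E`-null, so `y = 0`.
  have h1 : ‖A ⟨y, hyD⟩ - a • y‖ ^ 2 = 0 := by
    rw [hE'.norm_sub_smul_sq measurable_id' a ⟨y, hyD⟩]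
    simp only [hy, E'.diagMeasure_proj ha]
    simp
  rw [hE.norm_sub_smul_sq measurable_id' a ⟨y, hyD⟩, integral_eq_zero_iff_of_nonneg] at h1
  · have h2 : ∀ᵐ z ∂(E.diagMeasure y), z ≠ a := by
      rw [ae_iff]
      simpa using h y
    have h3 : E.diagMeasure y Set.univ = 0 := by
      rw [Measure.measure_univ_eq_zero, ← ae_eq_bot, ← eventually_false_iff_eq_bot]
      filter_upwards [h1, h2] with z hz hz'
      refine hz' (sub_eq_zero.1 ?_)
      simpa using hz
    rw [← E.proj_eq_zero_iff MeasurableSet.univ, E.univ] at h3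
    exact h3
  · exact fun z => by positivity
  · have hyD' : y ∈ E.integralDomain fun z => z := hE.domain_eq measurable_id' ▸ hyD
    exact (memLp_two_iff_integrable_sq_norm (measurable_id'.sub_const a).aestronglyMeasurable).1
      (MemLp.sub hyD' (memLp_const a))

end ResolutionOfIdentity

/-- One resolution of `A` guarantees that the choice is not the default value. The resolution
contained in the conclusion may differ from `E`. -/
theorem isFunctionOf_functionalCalculus {H : Type*} [NormedAddCommGroup H] [InnerProductSpace ℂ H]
    [CompleteSpace H] {f : ℂ → ℂ} (hf : Measurable f) {A : H →ₗ.[ℂ] H}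
    {E : ResolutionOfIdentity H} (hE : E.IsIntegral (fun z => z) A) :
    IsFunctionOf f A (functionalCalculus f A) := by
  have h : ∃ B, IsFunctionOf f A B := ⟨_, E, hE, E.isIntegral_integral hf⟩
  rw [functionalCalculus, dif_pos h]
  exact h.choose_spec

/-! ### Locally absolutely continuous functions and weak derivatives -/

section WeakDerivative

open Filter Topology
open scoped ContDiff

theorem AbsolutelyContinuousOnInterval.ofReal {f : ℝ → ℝ} {a b : ℝ}
    (hf : AbsolutelyContinuousOnInterval f a b) :
    AbsolutelyContinuousOnInterval (fun x => (f x : ℂ)) a b := by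
  unfold AbsolutelyContinuousOnInterval at hf ⊢
  simpa only [Complex.isometry_ofReal.dist_eq] using hf

theorem MeasureTheory.LocallyIntegrable.intervalIntegrable {F : Type*} [NormedAddCommGroup F]
    {f : ℝ → F} (hf : LocallyIntegrable f) (a b : ℝ) : IntervalIntegrable f volume a b :=
  intervalIntegrable_iff.2
    ((hf.integrableOn_isCompact isCompact_uIcc).mono_set Set.uIoc_subset_uIcc)

theorem isLocallyAC_integral {h : ℝ → ℂ} (hh : LocallyIntegrable h) :
    IsLocallyAC fun x => ∫ t in (0 : ℝ)..x, h t := by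
  intro a b
  have key : ∀ k : ℝ → ℝ, LocallyIntegrable k →
      AbsolutelyContinuousOnInterval (fun x => ((∫ t in (0 : ℝ)..x, k t : ℝ) : ℂ)) a b := by
    intro k hk
    -- The interval is enlarged to contain the base point `0` of the primitive.
    have h0 : (0 : ℝ) ∈ Set.uIcc (min 0 (min a b)) (max 0 (max a b)) := by
      rw [Set.uIcc_of_le (le_trans (min_le_left _ _) (le_max_left _ _))]
      exact ⟨min_le_left _ _, le_max_left _ _⟩
    have h1 := ((hk.intervalIntegrable (min 0 (min a b))
      (max 0 (max a b))).absolutelyContinuousOnInterval_intervalIntegral h0).ofReal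
    refine h1.mono ?_
    rw [Set.uIcc_of_le (a := min 0 (min a b)) (le_trans (min_le_left _ _) (le_max_left _ _))]
    exact Set.Icc_subset_Icc (min_le_right _ _) (le_max_right _ _)
  have hre : LocallyIntegrable fun t => (h t).re := fun x => by
    obtain ⟨s, hs, hi⟩ := hh x
    exact ⟨s, hs, hi.re⟩
  have him : LocallyIntegrable fun t => (h t).im := fun x => by
    obtain ⟨s, hs, hi⟩ := hh x
    exact ⟨s, hs, hi.im⟩
  have h2 := (key _ hre).add ((key _ him).const_smul Complex.I)
  refine (congrArg (AbsolutelyContinuousOnInterval · a b) (funext fun x => ?_)).mpr h2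
  simp only [Pi.add_apply, smul_eq_mul]
  rw [← intervalIntegral.integral_ofReal, ← intervalIntegral.integral_ofReal,
    ← intervalIntegral.integral_const_mul, ← intervalIntegral.integral_add]
  · refine intervalIntegral.integral_congr fun t _ => ?_
    rw [mul_comm]
    exact (Complex.re_add_im (h t)).symm
  · have h3 := hre.intervalIntegrable 0 x
    exact ⟨h3.1.ofReal, h3.2.ofReal⟩
  · have h3 := him.intervalIntegrable 0 x
    exact IntervalIntegrable.const_mul ⟨h3.1.ofReal, h3.2.ofReal⟩ _

/-- The difference from the primitive of `h` is absolutely continuous with zero derivative almost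
everywhere, hence constant. -/
theorem IsLocallyAC.eq_add_integral {g h : ℝ → ℂ} (hg : IsLocallyAC g)
    (hh : LocallyIntegrable h) (hd : ∀ᵐ t, HasDerivAt g (h t) t) (x : ℝ) :
    g x = g 0 + ∫ t in (0 : ℝ)..x, h t := by
  have hu : AbsolutelyContinuousOnInterval (g - fun x => ∫ t in (0 : ℝ)..x, h t) 0 x :=
    (hg 0 x).sub (isLocallyAC_integral hh 0 x)
  obtain ⟨C, hC⟩ := hu.const_of_ae_hasDerivAt_zero (by
    filter_upwards [hd, LocallyIntegrable.ae_hasDerivAt_integral hh] with t h1 h2 _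
    simpa using h1.sub (h2 0))
  have h0 := hC 0 Set.left_mem_uIcc
  have h1 := hC x Set.right_mem_uIcc
  simp only [Pi.sub_apply, intervalIntegral.integral_same, sub_zero] at h0 h1
  rw [h0, ← h1]
  ring

/-- The derivative of an integrable absolutely continuous function has integral zero. -/
theorem IsLocallyAC.integral_deriv_eq_zero {g h : ℝ → ℂ} (hg : IsLocallyAC g)
    (hgi : Integrable g) (hh : Integrable h) (hd : ∀ᵐ t, HasDerivAt g (h t) t) :
    ∫ t, h t = 0 := by
  have hE := hg.eq_add_integral hh.locallyIntegrable hd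
  -- Integrability of `h` gives `g` a limit at infinity, and integrability of `g` forces that limit
  -- to be zero.
  have htop : Tendsto g atTop (𝓝 0) := by
    have h1 : Tendsto g atTop (𝓝 (g 0 + ∫ t in Set.Ioi 0, h t)) := by
      have := (intervalIntegral_tendsto_integral_Ioi 0 hh.integrableOn tendsto_id).const_add (g 0)
      refine this.congr fun x => (hE x).symm
    have h2 := IntegrableAtFilter.eq_zero_of_tendsto (hgi.integrableAtFilter atTop) (fun s hs => by
      obtain ⟨b, hb⟩ := mem_atTop_sets.1 hs
      rw [← top_le_iff, ← Real.volume_Ici (a := b)]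
      exact measure_mono hb) h1
    rwa [h2] at h1
  have hbot : Tendsto g atBot (𝓝 0) := by
    have h1 : Tendsto g atBot (𝓝 (g 0 - ∫ t in Set.Iic 0, h t)) := by
      have := (intervalIntegral_tendsto_integral_Iic 0 hh.integrableOn tendsto_id).const_sub (g 0)
      refine this.congr fun x => ?_
      rw [hE x, intervalIntegral.integral_symm, sub_neg_eq_add]
      rfl
    have h2 := IntegrableAtFilter.eq_zero_of_tendsto (hgi.integrableAtFilter atBot) (fun s hs => by
      obtain ⟨b, hb⟩ := mem_atBot_sets.1 hs
      rw [← top_le_iff, ← Real.volume_Iic (a := b)]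
      exact measure_mono hb) h1
    rwa [h2] at h1
  have h3 := intervalIntegral_tendsto_integral hh tendsto_neg_atTop_atBot
    (tendsto_id (α := ℝ) (x := atTop))
  refine tendsto_nhds_unique h3 ?_
  have h4 : Tendsto (fun x : ℝ => g x - g (-x)) atTop (𝓝 (0 - 0)) :=
    htop.sub (hbot.comp tendsto_neg_atTop_atBot)
  rw [sub_zero] at h4
  refine h4.congr fun x => ?_
  have hi := fun a b => hh.locallyIntegrable.intervalIntegrable a b
  rw [hE x, hE (-x), add_sub_add_left_eq_sub,
    intervalIntegral.integral_interval_sub_left (hi _ _) (hi _ _)]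
  rfl

theorem ContDiff.isLocallyAC {g : ℝ → ℂ} (hg : ContDiff ℝ 1 g) : IsLocallyAC g :=
  fun _ _ => hg.contDiffOn.absolutelyContinuousOnInterval

theorem IsLocallyAC.mul {f g : ℝ → ℂ} (hf : IsLocallyAC f) (hg : IsLocallyAC g) :
    IsLocallyAC fun x => f x * g x :=
  fun a b => (hf a b).smul (hg a b)

theorem IsLocallyAC.ae_hasDerivAt {g : ℝ → ℂ} (hg : IsLocallyAC g) :
    ∀ᵐ t, HasDerivAt g (deriv g t) t := by
  filter_upwards [hg.ae_differentiableAt] with t ht using ht.hasDerivAt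

/-- Every smooth function with compact support and vanishing integral is the derivative of a
smooth function with compact support. -/
theorem exists_hasCompactSupport_deriv_eq {η : ℝ → ℝ} (hη : ContDiff ℝ ∞ η)
    (hc : HasCompactSupport η) (h0 : ∫ t, η t = 0) :
    ∃ ψ : ℝ → ℝ, ContDiff ℝ ∞ ψ ∧ HasCompactSupport ψ ∧ deriv ψ = η := by
  obtain ⟨R, hR⟩ := hc.isCompact.isBounded.subset_closedBall (0 : ℝ)
  rw [Real.closedBall_eq_Icc, zero_sub, zero_add] at hR
  have hout : ∀ t, t ∉ Set.Icc (-R) R → η t = 0 := fun t ht =>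
    image_eq_zero_of_notMem_tsupport fun h => ht (hR h)
  have hint : Integrable η := hη.continuous.integrable_of_hasCompactSupport hc
  -- The primitive from `-∞` vanishes to the left of the support, and to its right because the total
  -- integral is zero.
  let ψ : ℝ → ℝ := fun x => ∫ t in Set.Iic x, η t
  have hψ : ∀ x, ψ x = ψ 0 + ∫ t in (0 : ℝ)..x, η t := by
    intro x
    rw [← intervalIntegral.integral_Iic_sub_Iic hint.integrableOn hint.integrableOn]
    simp only [ψ]
    ring
  have hder : ∀ x, HasDerivAt ψ (η x) x := by
    intro x
    have h1 : HasDerivAt (fun x => ψ 0 + ∫ t in (0 : ℝ)..x, η t) (η x) x :=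
      (intervalIntegral.integral_hasDerivAt_right (hint.locallyIntegrable.intervalIntegrable 0 x)
        (hη.continuous.stronglyMeasurableAtFilter _ _) hη.continuous.continuousAt).const_add _
    exact h1.congr_of_eventuallyEq (Eventually.of_forall hψ)
  have hd : deriv ψ = η := funext fun x => (hder x).deriv
  refine ⟨ψ, ?_, ?_, hd⟩
  · rw [contDiff_infty_iff_deriv, hd]
    exact ⟨fun x => (hder x).differentiableAt, hη⟩
  · refine HasCompactSupport.intro (isCompact_Icc (a := -R) (b := R)) fun x hx => ?_
    simp only [ψ]
    by_cases hxR : x < -R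
    · refine setIntegral_eq_zero_of_forall_eq_zero fun t ht => hout t fun h => ?_
      have := Set.mem_Iic.1 ht
      linarith [h.1]
    · have hx2 : R < x := by
        by_contra h
        exact hx ⟨not_lt.1 hxR, not_lt.1 h⟩
      rw [← h0]
      refine setIntegral_eq_integral_of_forall_compl_eq_zero fun t ht => hout t fun h => ?_
      exact ht (Set.mem_Iic.2 (h.2.trans hx2.le))

/-- The lemma of du Bois-Reymond. -/
theorem exists_ae_eq_const_of_integral_deriv_smul_eq_zero {k : ℝ → ℂ} (hk : LocallyIntegrable k)
    (h : ∀ ψ : ℝ → ℝ, ContDiff ℝ ∞ ψ → HasCompactSupport ψ → ∫ t, deriv ψ t • k t = 0) :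
    ∃ C : ℂ, ∀ᵐ t, k t = C := by
  let b : ContDiffBump (0 : ℝ) := ⟨1, 2, one_pos, one_lt_two⟩
  let χ : ℝ → ℝ := b.normed volume
  have hχ : ContDiff ℝ ∞ χ := b.contDiff_normed
  have hχc : HasCompactSupport χ := b.hasCompactSupport_normed
  have hχ1 : ∫ t, χ t = 1 := b.integral_normed
  have hki : ∀ φ : ℝ → ℝ, Continuous φ → HasCompactSupport φ →
      Integrable fun t => φ t • k t := fun φ hφ hφc =>
    hk.integrable_smul_left_of_hasCompactSupport hφ hφc
  refine ⟨∫ t, χ t • k t, ae_eq_of_integral_contDiff_smul_eq hk (locallyIntegrable_const _) ?_⟩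
  intro φ hφ hφc
  have hφi : Integrable φ := hφ.continuous.integrable_of_hasCompactSupport hφc
  have hχi : Integrable χ := hχ.continuous.integrable_of_hasCompactSupport hχc
  -- Subtracting `(∫ φ) χ` from a test function leaves integral zero, hence a derivative of a test
  -- function; this fixes the constant as `∫ χ k`.
  obtain ⟨ψ, hψ, hψc, hψd⟩ := exists_hasCompactSupport_deriv_eq
    (η := fun t => φ t - (∫ s, φ s) * χ t) (hφ.sub (contDiff_const.mul hχ))
    (hφc.sub (hχc.mul_left)) (by
      rw [integral_sub hφi (hχi.const_mul _), integral_const_mul, hχ1, mul_one, sub_self])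
  have h1 := h ψ hψ hψc
  rw [hψd] at h1
  simp only [sub_smul, mul_smul] at h1
  rw [integral_sub (hki φ hφ.continuous hφc) ((hki χ hχ.continuous hχc).fun_smul _),
    integral_smul, sub_eq_zero] at h1
  rw [h1, integral_smul_const]

/-- A locally integrable function with a locally integrable weak derivative agrees almost
everywhere with a locally absolutely continuous function. -/
theorem exists_isLocallyAC_of_weak_deriv {f h : ℝ → ℂ} (hf : LocallyIntegrable f)
    (hh : LocallyIntegrable h)
    (hw : ∀ ψ : ℝ → ℝ, ContDiff ℝ ∞ ψ → HasCompactSupport ψ →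
      ∫ t, deriv ψ t • f t = -∫ t, ψ t • h t) :
    ∃ g, IsLocallyAC g ∧ f =ᵐ[volume] g ∧ ∀ᵐ t, HasDerivAt g (h t) t := by
  set G : ℝ → ℂ := fun x => ∫ t in (0 : ℝ)..x, h t with hG
  have hGac : IsLocallyAC G := isLocallyAC_integral hh
  have hGd : ∀ᵐ t, HasDerivAt G (h t) t := by
    filter_upwards [LocallyIntegrable.ae_hasDerivAt_integral hh] with t ht using ht 0
  -- `f` and the primitive `G` of `h` have the same weak derivative, by integrating `(ψ G)'`, so
  -- they differ by a constant.
  obtain ⟨C, hC⟩ := exists_ae_eq_const_of_integral_deriv_smul_eq_zero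
    (k := fun t => f t - G t) (hf.sub hGac.continuous.locallyIntegrable) (by
    intro ψ hψ hψc
    have hψ1 : ContDiff ℝ 1 ψ := hψ.of_le (by norm_cast)
    have hdc : Continuous (deriv ψ) := hψ1.continuous_deriv le_rfl
    have i1 : Integrable fun t => deriv ψ t • f t :=
      hf.integrable_smul_left_of_hasCompactSupport hdc hψc.deriv
    have i2 : Integrable fun t => deriv ψ t • G t :=
      hGac.continuous.locallyIntegrable.integrable_smul_left_of_hasCompactSupport hdc hψc.deriv
    have i3 : Integrable fun t => ψ t • h t :=
      hh.integrable_smul_left_of_hasCompactSupport hψ.continuous hψc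
    have i4 : Integrable fun t => (ψ t : ℂ) * G t := by
      simpa using hGac.continuous.locallyIntegrable.integrable_smul_left_of_hasCompactSupport
        hψ.continuous hψc
    have hz := ((Complex.ofRealCLM.contDiff.comp hψ1).isLocallyAC.mul hGac).integral_deriv_eq_zero
      i4 (i2.add i3) (by
        filter_upwards [hGd] with t ht
        exact ((hψ1.differentiable one_ne_zero t).hasDerivAt.ofReal_comp).mul ht)
    simp only [Pi.add_apply] at hz
    rw [integral_add i2 i3] at hz
    simp only [smul_sub]
    rw [integral_sub i1 i2, hw ψ hψ hψc]
    linear_combination -hz)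
  refine ⟨fun x => G x + C, fun a b => (hGac a b).add ?_, ?_, ?_⟩
  · exact (LipschitzWith.const C).lipschitzOnWith.absolutelyContinuousOnInterval
  · filter_upwards [hC] with t ht
    rw [← ht]
    ring
  · filter_upwards [hGd] with t ht using ht.add_const C

end WeakDerivative

/-! ### Differentiation and the Fourier transform on `L²(ℝ)` -/

section FourierDerivative

open Filter Topology FourierTransform SchwartzMap TemperedDistribution LineDeriv
open scoped ContDiff Real

theorem SchwartzMap.lineDerivOp_one_apply (φ : 𝓢(ℝ, ℂ)) (x : ℝ) :
    (∂_{(1 : ℝ)} φ) x = deriv φ x := by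
  rw [SchwartzMap.lineDerivOp_apply_eq_fderiv]
  exact fderiv_apply_one_eq_deriv

theorem isLocallyAC_weak_deriv {f h : Lp ℂ 2 (volume : Measure ℝ)} {g : ℝ → ℂ}
    (hg : IsLocallyAC g) (hfg : f =ᵐ[volume] g) (hhg : h =ᵐ[volume] deriv g) (φ : 𝓢(ℝ, ℂ)) :
    ∫ t, φ t * h t = -∫ t, deriv φ t * f t := by
  have hφ : MemLp φ 2 volume := φ.memLp 2 volume
  have hφ' : MemLp (deriv φ) 2 volume := by
    have := (∂_{(1 : ℝ)} φ).memLp 2 volume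
    exact this.congr_norm (φ.smooth 1).continuous_deriv_one.aestronglyMeasurable
      (Eventually.of_forall fun x => by rw [SchwartzMap.lineDerivOp_one_apply])
  have i1 : Integrable fun t => φ t * h t := hφ.integrable_mul (Lp.memLp h)
  have i2 : Integrable fun t => deriv φ t * f t := hφ'.integrable_mul (Lp.memLp f)
  have i3 : Integrable fun t => φ t * g t := by
    refine (hφ.integrable_mul (Lp.memLp f)).congr ?_
    filter_upwards [hfg] with t ht
    simp [ht]
  have hz := ((φ.smooth 1).isLocallyAC.mul hg).integral_deriv_eq_zero i3 (i2.add i1) (by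
    filter_upwards [hg.ae_hasDerivAt, hfg, hhg] with t ht h1 h2
    simp only [Pi.add_apply, h1, h2]
    exact (φ.differentiableAt.hasDerivAt).mul ht)
  simp only [Pi.add_apply] at hz
  rw [integral_add i2 i1] at hz
  linear_combination hz

theorem weak_deriv_iff_toTemperedDistribution {f h : Lp ℂ 2 (volume : Measure ℝ)} :
    (∀ φ : 𝓢(ℝ, ℂ), ∫ t, φ t * h t = -∫ t, deriv φ t * f t) ↔
      (h : 𝓢'(ℝ, ℂ)) = ∂_{(1 : ℝ)} (f : 𝓢'(ℝ, ℂ)) := by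
  have key : ∀ φ : 𝓢(ℝ, ℂ), (∂_{(1 : ℝ)} (f : 𝓢'(ℝ, ℂ))) φ = -∫ t, deriv φ t * f t := by
    intro φ
    rw [TemperedDistribution.lineDerivOp_apply_apply, map_neg,
      Lp.toTemperedDistribution_apply]
    simp only [SchwartzMap.lineDerivOp_one_apply, smul_eq_mul]
  constructor
  · intro H
    ext φ
    rw [key, ← H, Lp.toTemperedDistribution_apply]
    rfl
  · intro H φ
    rw [← key, ← H, Lp.toTemperedDistribution_apply]
    rfl

theorem fourier_deriv_toTemperedDistribution_apply (f : Lp ℂ 2 (volume : Measure ℝ))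
    (φ : 𝓢(ℝ, ℂ)) :
    (𝓕 (∂_{(1 : ℝ)} (f : 𝓢'(ℝ, ℂ)))) φ =
      ∫ ξ, φ ξ * (2 * π * Complex.I * ξ * (𝓕 f : Lp ℂ 2 (volume : Measure ℝ)) ξ) := by
  have hg' : (fun x : ℝ => ((inner ℝ x 1 : ℝ) : ℂ)).HasTemperateGrowth := by fun_prop
  rw [TemperedDistribution.fourier_lineDerivOp_eq, Lp.fourier_toTemperedDistribution_eq]
  simp only [smul_apply, TemperedDistribution.smulLeftCLM_apply_apply,
    Lp.toTemperedDistribution_apply, SchwartzMap.smulLeftCLM_apply_apply hg', smul_eq_mul]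
  rw [← integral_const_mul]
  refine integral_congr_ae (Eventually.of_forall fun ξ => ?_)
  simp
  ring

/-- A square integrable function is absolutely continuous with derivative `h` in `L²` if and only
if its Fourier transform satisfies `𝓕 h = 2πiξ 𝓕 f`. -/
theorem exists_isLocallyAC_iff_fourier {f h : Lp ℂ 2 (volume : Measure ℝ)} :
    (∃ g : ℝ → ℂ, IsLocallyAC g ∧ f =ᵐ[volume] g ∧ h =ᵐ[volume] deriv g) ↔
      ∀ᵐ ξ : ℝ, (𝓕 h : Lp ℂ 2 (volume : Measure ℝ)) ξ =
        2 * π * Complex.I * ξ * (𝓕 f : Lp ℂ 2 (volume : Measure ℝ)) ξ := by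
  have hloc : ∀ u : Lp ℂ 2 (volume : Measure ℝ), LocallyIntegrable u := fun u =>
    (Lp.memLp u).locallyIntegrable one_le_two
  -- Absolute continuity is traded for `h = f'` as tempered distributions, where the Fourier
  -- transform applies without domain conditions.
  have hiff : (∃ g : ℝ → ℂ, IsLocallyAC g ∧ f =ᵐ[volume] g ∧ h =ᵐ[volume] deriv g) ↔
      (h : 𝓢'(ℝ, ℂ)) = ∂_{(1 : ℝ)} (f : 𝓢'(ℝ, ℂ)) := by
    rw [← weak_deriv_iff_toTemperedDistribution]
    constructor
    · rintro ⟨g, hg, hfg, hhg⟩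
      exact isLocallyAC_weak_deriv hg hfg hhg
    · intro H
      obtain ⟨g, hg, hfg, hd⟩ := exists_isLocallyAC_of_weak_deriv (hloc f) (hloc h) (by
        intro ψ hψ hψc
        have hc : HasCompactSupport fun x => (ψ x : ℂ) := hψc.comp_left Complex.ofReal_zero
        have h1 := H (hc.toSchwartzMap (Complex.ofRealCLM.contDiff.comp hψ))
        have h2 : ∀ t, deriv (hc.toSchwartzMap (Complex.ofRealCLM.contDiff.comp hψ)) t =
            ((deriv ψ t : ℝ) : ℂ) := fun t =>
          ((hψ.differentiable (by simp) t).hasDerivAt.ofReal_comp).deriv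
        simp only [h2] at h1
        simp only [Complex.real_smul]
        rw [← neg_eq_iff_eq_neg, ← h1]
        rfl)
      refine ⟨g, hg, hfg, ?_⟩
      filter_upwards [hd] with t ht using ht.deriv.symm
  rw [hiff]
  have hF : ∀ φ : 𝓢(ℝ, ℂ), (𝓕 (h : 𝓢'(ℝ, ℂ))) φ =
      ∫ ξ, φ ξ * (𝓕 h : Lp ℂ 2 (volume : Measure ℝ)) ξ := by
    intro φ
    rw [Lp.fourier_toTemperedDistribution_eq, Lp.toTemperedDistribution_apply]
    rfl
  constructor
  · intro H
    refine ae_eq_of_integral_contDiff_smul_eq (hloc _) ?_ ?_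
    · refine locallyIntegrable_iff.2 fun K hK => ?_
      refine IntegrableOn.continuousOn_mul ?_ ((hloc _).integrableOn_isCompact hK) hK
      fun_prop
    · intro ψ hψ hψc
      have hc : HasCompactSupport fun x => (ψ x : ℂ) := hψc.comp_left Complex.ofReal_zero
      have h1 := hF (hc.toSchwartzMap (Complex.ofRealCLM.contDiff.comp hψ))
      rw [H, fourier_deriv_toTemperedDistribution_apply] at h1
      simp only [Complex.real_smul]
      exact h1.symm
  · intro H
    have h1 : 𝓕 (h : 𝓢'(ℝ, ℂ)) = 𝓕 (∂_{(1 : ℝ)} (f : 𝓢'(ℝ, ℂ))) := by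
      ext φ
      rw [hF, fourier_deriv_toTemperedDistribution_apply]
      refine integral_congr_ae ?_
      filter_upwards [H] with ξ hξ
      rw [hξ]
    have h2 := congrArg (fun u : 𝓢'(ℝ, ℂ) => 𝓕⁻ u) h1
    simpa using h2

end FourierDerivative

/-! ### Resolutions of the identity given by multiplication operators -/

section Multiplication

open Filter Topology

/-- In a Hilbert space, an orthogonal series of projections of `y` converges to `y` if the squares
of the norms add up. -/
theorem hasSum_of_orthogonal {H ι : Type*} [NormedAddCommGroup H] [InnerProductSpace ℂ H]
    {x : ι → H} {y : H} (ho : Pairwise fun m n => ⟪x m, x n⟫_ℂ = 0)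
    (hy : ∀ n, ⟪x n, y⟫_ℂ = ((‖x n‖ ^ 2 : ℝ) : ℂ)) (hs : HasSum (fun n => ‖x n‖ ^ 2) (‖y‖ ^ 2)) :
    HasSum x y := by
  have key : ∀ s : Finset ι, ‖∑ n ∈ s, x n - y‖ ^ 2 = ‖y‖ ^ 2 - ∑ n ∈ s, ‖x n‖ ^ 2 := by
    intro s
    have h1 : ⟪∑ n ∈ s, x n, y⟫_ℂ = ((∑ n ∈ s, ‖x n‖ ^ 2 : ℝ) : ℂ) := by
      rw [sum_inner, Complex.ofReal_sum]
      exact Finset.sum_congr rfl fun n _ => hy n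
    have h2 : ⟪∑ n ∈ s, x n, ∑ n ∈ s, x n⟫_ℂ = ((∑ n ∈ s, ‖x n‖ ^ 2 : ℝ) : ℂ) := by
      rw [sum_inner, Complex.ofReal_sum]
      refine Finset.sum_congr rfl fun n hn => ?_
      rw [inner_sum, Finset.sum_eq_single n (fun m _ hm => ho hm.symm) (fun h => absurd hn h),
        inner_self_eq_norm_sq_to_K]
      simp
    rw [inner_self_eq_norm_sq_to_K] at h2
    have h3 : ‖∑ n ∈ s, x n‖ ^ 2 = ∑ n ∈ s, ‖x n‖ ^ 2 := by
      have h4 : ((‖∑ n ∈ s, x n‖ ^ 2 : ℝ) : ℂ) = ((∑ n ∈ s, ‖x n‖ ^ 2 : ℝ) : ℂ) := by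
        rw [← h2]
        simp
      exact Complex.ofReal_injective h4
    rw [norm_sub_sq (𝕜 := ℂ), h1, h3, RCLike.re_to_complex, Complex.ofReal_re]
    ring
  rw [HasSum, SummationFilter.unconditional_filter, tendsto_iff_norm_sub_tendsto_zero]
  have h1 : Tendsto (fun s : Finset ι => ‖y‖ ^ 2 - ∑ n ∈ s, ‖x n‖ ^ 2) atTop (𝓝 0) := by
    have : Tendsto (fun s : Finset ι => ∑ n ∈ s, ‖x n‖ ^ 2) atTop (𝓝 (‖y‖ ^ 2)) := hs
    have h := this.const_sub (‖y‖ ^ 2)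
    rwa [sub_self] at h
  have h2 := h1.sqrt
  rw [Real.sqrt_zero] at h2
  refine h2.congr fun s => ?_
  rw [← key, Real.sqrt_sq (norm_nonneg _)]

variable {α : Type*} [MeasurableSpace α] {ν : Measure α}

/-- Multiplication by the indicator function of a measurable set on `L²`. -/
noncomputable def indicatorMul (ν : Measure α) {S : Set α} (hS : MeasurableSet S) :
    Lp ℂ 2 ν →L[ℂ] Lp ℂ 2 ν :=
  LinearMap.mkContinuous
    { toFun := fun u => ((Lp.memLp u).indicator hS).toLp
      map_add' := by
        intro u v
        ext1
        filter_upwards [((Lp.memLp (u + v)).indicator hS).coeFn_toLp,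
          Lp.coeFn_add (((Lp.memLp u).indicator hS).toLp) (((Lp.memLp v).indicator hS).toLp),
          ((Lp.memLp u).indicator hS).coeFn_toLp, ((Lp.memLp v).indicator hS).coeFn_toLp,
          Lp.coeFn_add u v] with t h1 h2 h3 h4 h5
        rw [h1, h2, Pi.add_apply, h3, h4]
        by_cases ht : t ∈ S
        · simpa only [Set.indicator_of_mem ht, Pi.add_apply] using h5
        · simp [ht]
      map_smul' := by
        intro a u
        ext1
        filter_upwards [((Lp.memLp (a • u)).indicator hS).coeFn_toLp,
          Lp.coeFn_smul a (((Lp.memLp u).indicator hS).toLp),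
          ((Lp.memLp u).indicator hS).coeFn_toLp,
          Lp.coeFn_smul a u] with t h1 h2 h3 h5
        rw [RingHom.id_apply, h1, h2, Pi.smul_apply, h3]
        by_cases ht : t ∈ S <;> simp [ht, h5] }
    1 (by
      intro u
      rw [one_mul]
      refine Lp.norm_le_norm_of_ae_le ?_
      filter_upwards [((Lp.memLp u).indicator hS).coeFn_toLp] with t ht
      refine (congrArg norm ht).trans_le ?_
      exact norm_indicator_le_norm_self _ _)

theorem coeFn_indicatorMul {S : Set α} (hS : MeasurableSet S) (u : Lp ℂ 2 ν) :
    indicatorMul ν hS u =ᵐ[ν] S.indicator u :=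
  ((Lp.memLp u).indicator hS).coeFn_toLp

theorem indicatorMul_indicatorMul {S T : Set α} (hS : MeasurableSet S) (hT : MeasurableSet T)
    (u : Lp ℂ 2 ν) :
    indicatorMul ν hS (indicatorMul ν hT u) = indicatorMul ν (hS.inter hT) u := by
  ext1
  filter_upwards [coeFn_indicatorMul hS (indicatorMul ν hT u), coeFn_indicatorMul hT u,
    coeFn_indicatorMul (hS.inter hT) u] with t h1 h2 h3
  rw [h1, h3, ← Set.indicator_indicator]
  by_cases ht : t ∈ S <;> simp [ht, h2]

theorem inner_indicatorMul_left {S : Set α} (hS : MeasurableSet S) (u v : Lp ℂ 2 ν) :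
    ⟪indicatorMul ν hS u, v⟫_ℂ = ⟪u, indicatorMul ν hS v⟫_ℂ := by
  rw [L2.inner_def, L2.inner_def]
  refine integral_congr_ae ?_
  filter_upwards [coeFn_indicatorMul hS u, coeFn_indicatorMul hS v] with t h1 h2
  rw [h1, h2]
  by_cases ht : t ∈ S <;> simp [ht]

theorem ofReal_norm_sq_eq_lintegral (u : Lp ℂ 2 ν) :
    ENNReal.ofReal (‖u‖ ^ 2) = ∫⁻ t, ‖u t‖ₑ ^ 2 ∂ν := by
  rw [ENNReal.ofReal_pow (norm_nonneg _), ofReal_norm, Lp.enorm_def,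
    eLpNorm_eq_lintegral_rpow_enorm_toReal (by norm_num) (by norm_num)]
  simp only [ENNReal.toReal_ofNat, ENNReal.rpow_ofNat]
  rw [← ENNReal.rpow_ofNat, ← ENNReal.rpow_mul]
  norm_num

theorem ofReal_norm_indicatorMul_sq {S : Set α} (hS : MeasurableSet S) (u : Lp ℂ 2 ν) :
    ENNReal.ofReal (‖indicatorMul ν hS u‖ ^ 2) =
      ν.withDensity (fun t => ‖u t‖ₑ ^ 2) S := by
  rw [ofReal_norm_sq_eq_lintegral, withDensity_apply _ hS, ← lintegral_indicator hS]
  refine lintegral_congr_ae ?_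
  filter_upwards [coeFn_indicatorMul hS u] with t ht
  rw [ht]
  by_cases h : t ∈ S <;> simp [h]

/-- The pieces are orthogonal and their squared norms are the values of the finite measure `|u|² dν`
on disjoint sets. -/
theorem hasSum_indicatorMul {S : ℕ → Set α} (hS : ∀ n, MeasurableSet (S n))
    (hd : Pairwise (Function.onFun Disjoint S)) (u : Lp ℂ 2 ν) :
    HasSum (fun n => indicatorMul ν (hS n) u) (indicatorMul ν (MeasurableSet.iUnion hS) u) := by
  have hself : ∀ {T : Set α} (hT : MeasurableSet T),
      ⟪u, indicatorMul ν hT u⟫_ℂ = ((‖indicatorMul ν hT u‖ ^ 2 : ℝ) : ℂ) := by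
    intro T hT
    have h1 : indicatorMul ν hT u = indicatorMul ν hT (indicatorMul ν hT u) := by
      rw [indicatorMul_indicatorMul]
      congr 2
      exact (Set.inter_self T).symm
    rw [h1, ← inner_indicatorMul_left, ← h1, inner_self_eq_norm_sq_to_K]
    simp
  refine hasSum_of_orthogonal (fun m n hmn => ?_) (fun n => ?_) ?_
  · beta_reduce
    rw [inner_indicatorMul_left, indicatorMul_indicatorMul]
    have h1 : indicatorMul ν ((hS m).inter (hS n)) u = 0 := by
      have h2 : ENNReal.ofReal (‖indicatorMul ν ((hS m).inter (hS n)) u‖ ^ 2) = 0 :=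
        (ofReal_norm_indicatorMul_sq ((hS m).inter (hS n)) u).trans
          (measure_mono_null (hd hmn).inter_eq.subset measure_empty)
      rw [ENNReal.ofReal_eq_zero] at h2
      have h3 := le_antisymm h2 (by positivity)
      simpa using h3
    rw [h1, inner_zero_right]
  · rw [inner_indicatorMul_left, indicatorMul_indicatorMul]
    have : S n ∩ ⋃ i, S i = S n := Set.inter_eq_left.2 (Set.subset_iUnion S n)
    simp only [this]
    exact hself (hS n)
  · have h1 : ∀ {T : Set α} (hT : MeasurableSet T), ‖indicatorMul ν hT u‖ ^ 2 =
        (ν.withDensity (fun t => ‖u t‖ₑ ^ 2) T).toReal := by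
      intro T hT
      rw [← ofReal_norm_indicatorMul_sq hT, ENNReal.toReal_ofReal (by positivity)]
    simp only [h1]
    have h2 := measure_iUnion (μ := ν.withDensity fun t => ‖u t‖ₑ ^ 2) hd hS
    have h3 : ν.withDensity (fun t => ‖u t‖ₑ ^ 2) (⋃ n, S n) ≠ ∞ := by
      rw [← ofReal_norm_indicatorMul_sq (MeasurableSet.iUnion hS)]
      exact ENNReal.ofReal_ne_top
    rw [h2] at h3 ⊢
    rw [ENNReal.tsum_toReal_eq (ENNReal.ne_top_of_tsum_ne_top h3)]
    exact ENNReal.hasSum_toReal h3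

variable {H : Type*} [NormedAddCommGroup H] [InnerProductSpace ℂ H] [CompleteSpace H]

open Classical in
/-- The resolution of the identity of the operator that a unitary map `U` onto an `L²` space
transforms into multiplication by `a`. -/
noncomputable def multiplicationResolution (U : H ≃ₗᵢ[ℂ] Lp ℂ 2 ν) {a : α → ℂ}
    (ha : Measurable a) : ResolutionOfIdentity H where
  proj S := if hS : MeasurableSet S then
    (U.symm.toContinuousLinearEquiv : Lp ℂ 2 ν →L[ℂ] H) ∘L indicatorMul ν (ha hS) ∘L
      (U.toContinuousLinearEquiv : H →L[ℂ] Lp ℂ 2 ν) else 0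
  isStarProjection S hS := by
    rw [dif_pos hS]
    constructor
    · ext x
      simp [indicatorMul_indicatorMul]
    · rw [ContinuousLinearMap.isSelfAdjoint_iff_isSymmetric]
      intro x y
      have h1 : ∀ u y, ⟪U.symm u, y⟫_ℂ = ⟪u, U y⟫_ℂ := fun u y => by
        rw [← U.inner_map_map, U.apply_symm_apply]
      have h2 : ∀ u y, ⟪y, U.symm u⟫_ℂ = ⟪U y, u⟫_ℂ := fun u y => by
        rw [← U.inner_map_map, U.apply_symm_apply]
      simp [h1, h2, inner_indicatorMul_left]
  empty := by
    rw [dif_pos MeasurableSet.empty]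
    ext x
    simp only [ContinuousLinearMap.comp_apply, zero_apply]
    have h1 : indicatorMul ν (ha MeasurableSet.empty) (U x) = 0 := by
      ext1
      filter_upwards [coeFn_indicatorMul (ha MeasurableSet.empty) (U x),
        Lp.coeFn_zero ℂ 2 ν] with t h1 h2
      rw [h1, h2]
      simp
    simp [h1]
  univ := by
    rw [dif_pos MeasurableSet.univ]
    ext x
    have h1 : indicatorMul ν (ha MeasurableSet.univ) (U x) = U x := by
      ext1
      filter_upwards [coeFn_indicatorMul (ha MeasurableSet.univ) (U x)] with t h1
      rw [h1]
      simp
    change U.symm (indicatorMul ν (ha MeasurableSet.univ) (U x)) = x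
    rw [h1, U.symm_apply_apply]
  inter S S' hS hS' := by
    rw [dif_pos hS, dif_pos hS', dif_pos (hS.inter hS')]
    ext x
    simp [indicatorMul_indicatorMul]
  iUnion S hS hd x := by
    simp only [hS, MeasurableSet.iUnion hS, dif_pos]
    have h1 := hasSum_indicatorMul (ν := ν) (fun n => ha (hS n))
      (fun m n hmn => (hd hmn).preimage a) (U x)
    have h2 := (U.symm.toContinuousLinearEquiv : Lp ℂ 2 ν →L[ℂ] H).hasSum h1
    simp only [Set.preimage_iUnion]
    exact h2

theorem diagMeasure_multiplicationResolution (U : H ≃ₗᵢ[ℂ] Lp ℂ 2 ν) {a : α → ℂ}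
    (ha : Measurable a) (x : H) :
    (multiplicationResolution U ha).diagMeasure x =
      (ν.withDensity fun t => ‖U x t‖ₑ ^ 2).map a := by
  ext S hS
  rw [Measure.map_apply ha hS, ResolutionOfIdentity.diagMeasure_apply _ hS,
    ← ofReal_norm_indicatorMul_sq (ha hS)]
  simp only [multiplicationResolution, dif_pos hS]
  congr 2
  exact U.symm.norm_map _

end Multiplication

/-! ### The spectral resolution of the momentum operator -/

section Momentum

open Filter Topology FourierTransform
open scoped Real

/-- The function `t ↦ e^{bt}`, with complex values. -/
noncomputable def expWeight (b t : ℝ) : ℂ := (Real.exp (b * t) : ℂ)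

theorem continuous_expWeight (b : ℝ) : Continuous (expWeight b) := by
  unfold expWeight
  fun_prop

theorem expWeight_mul_expWeight_neg (b t : ℝ) : expWeight b t * expWeight (-b) t = 1 := by
  rw [expWeight, expWeight, ← Complex.ofReal_mul, ← Real.exp_add]
  simp

theorem hasDerivAt_expWeight (b t : ℝ) : HasDerivAt (expWeight b) (b * expWeight b t) t := by
  have h : HasDerivAt (fun t : ℝ => Real.exp (b * t)) (Real.exp (b * t) * (b * 1)) t :=
    ((hasDerivAt_id t).const_mul b).exp
  have h2 := h.ofReal_comp
  rw [mul_one] at h2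
  refine h2.congr_deriv ?_
  simp only [expWeight, Complex.ofReal_mul, mul_comm]

theorem isLocallyAC_expWeight (b : ℝ) : IsLocallyAC (expWeight b) := by
  refine ContDiff.isLocallyAC ?_
  unfold expWeight
  exact Complex.ofRealCLM.contDiff.comp (Real.contDiff_exp.comp (contDiff_const.mul contDiff_id))

theorem lintegral_expWeight_mul (c : ℝ) (f : ℝ → ℂ) :
    ∫⁻ t, ‖expWeight (-c) t * f t‖ₑ ^ 2 = ∫⁻ t, ‖f t‖ₑ ^ 2 ∂(weightMeasure c) := by
  have hm : Measurable fun t : ℝ => ENNReal.ofReal (Real.exp (-2 * c * t)) := by fun_prop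
  rw [weightMeasure, lintegral_withDensity_eq_lintegral_mul_non_measurable _ hm
    (Eventually.of_forall fun t => ENNReal.ofReal_lt_top)]
  refine lintegral_congr fun t => ?_
  rw [enorm_mul, mul_pow, Pi.mul_apply]
  congr 1
  rw [expWeight, ← ofReal_norm, Complex.norm_real, Real.norm_of_nonneg (Real.exp_pos _).le,
    ← ENNReal.ofReal_pow (Real.exp_pos _).le, ← Real.exp_nat_mul]
  congr 2
  push_cast
  ring

theorem eLpNorm_expWeight_mul (c : ℝ) (f : ℝ → ℂ) :
    eLpNorm (fun t => expWeight (-c) t * f t) 2 volume = eLpNorm f 2 (weightMeasure c) := by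
  have h := lintegral_expWeight_mul c f
  rw [eLpNorm_eq_lintegral_rpow_enorm_toReal (by norm_num) (by norm_num),
    eLpNorm_eq_lintegral_rpow_enorm_toReal (by norm_num) (by norm_num)]
  simp only [ENNReal.toReal_ofNat, ENNReal.rpow_ofNat, h]

theorem weightMeasure_absolutelyContinuous (c : ℝ) : volume ≪ weightMeasure c := by
  refine Measure.AbsolutelyContinuous.mk fun s _ hs => ?_
  have h : ∀ᵐ t ∂(weightMeasure c), t ∉ s := by
    rw [ae_iff]
    simpa using hs
  have h2 := (weightMeasure_ae_iff c).1 h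
  rw [ae_iff] at h2
  simpa using h2

theorem memLp_expWeight_mul {c : ℝ} {f : ℝ → ℂ} (hf : MemLp f 2 (weightMeasure c)) :
    MemLp (fun t => expWeight (-c) t * f t) 2 volume := by
  refine ⟨?_, by rw [eLpNorm_expWeight_mul]; exact hf.2⟩
  exact (continuous_expWeight _).aestronglyMeasurable.mul
    (hf.1.mono_ac (weightMeasure_absolutelyContinuous c))

theorem memLp_weightMeasure {c : ℝ} {f : ℝ → ℂ} (hf : MemLp f 2 volume) :
    MemLp (fun t => expWeight c t * f t) 2 (weightMeasure c) := by
  refine ⟨?_, ?_⟩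
  · exact ((continuous_expWeight _).aestronglyMeasurable.mul hf.1).mono_ac
      (withDensity_absolutelyContinuous _ _)
  · rw [← eLpNorm_expWeight_mul]
    have : (fun t => expWeight (-c) t * (expWeight c t * f t)) = f := by
      funext t
      rw [← mul_assoc, mul_comm (expWeight (-c) t), expWeight_mul_expWeight_neg, one_mul]
    rw [this]
    exact hf.2

/-- Multiplication by `e^{-ct}` as a linear isometry `ℍ_c → L²(ℝ)`. -/
noncomputable def weightLI (c : ℝ) : WeightedL2 c →ₗᵢ[ℂ] Lp ℂ 2 (volume : Measure ℝ) where
  toFun u := (memLp_expWeight_mul (Lp.memLp u)).toLp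
  map_add' u v := by
    ext1
    filter_upwards [(memLp_expWeight_mul (Lp.memLp (u + v))).coeFn_toLp,
      Lp.coeFn_add (memLp_expWeight_mul (Lp.memLp u)).toLp (memLp_expWeight_mul (Lp.memLp v)).toLp,
      (memLp_expWeight_mul (Lp.memLp u)).coeFn_toLp, (memLp_expWeight_mul (Lp.memLp v)).coeFn_toLp,
      (weightMeasure_ae_iff c).1 (Lp.coeFn_add u v)] with t h1 h2 h3 h4 h5
    rw [h1, h2, Pi.add_apply, h3, h4, h5, Pi.add_apply, mul_add]
  map_smul' a u := by
    ext1
    filter_upwards [(memLp_expWeight_mul (Lp.memLp (a • u))).coeFn_toLp,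
      Lp.coeFn_smul a (memLp_expWeight_mul (Lp.memLp u)).toLp,
      (memLp_expWeight_mul (Lp.memLp u)).coeFn_toLp,
      (weightMeasure_ae_iff c).1 (Lp.coeFn_smul a u)] with t h1 h2 h3 h5
    rw [RingHom.id_apply, h1, h2, Pi.smul_apply, h3, h5, Pi.smul_apply, smul_eq_mul, smul_eq_mul]
    ring
  norm_map' u := by
    change ‖(memLp_expWeight_mul (Lp.memLp u)).toLp‖ = _
    rw [Lp.norm_toLp, eLpNorm_expWeight_mul, Lp.norm_def]

theorem coeFn_weightLI {c : ℝ} (u : WeightedL2 c) :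
    weightLI c u =ᵐ[volume] fun t => expWeight (-c) t * u t :=
  (memLp_expWeight_mul (Lp.memLp u)).coeFn_toLp

theorem weightLI_surjective (c : ℝ) : Function.Surjective (weightLI c) := by
  intro v
  refine ⟨(memLp_weightMeasure (c := c) (Lp.memLp v)).toLp, ?_⟩
  ext1
  filter_upwards [coeFn_weightLI (memLp_weightMeasure (c := c) (Lp.memLp v)).toLp,
    (weightMeasure_ae_iff c).1 (memLp_weightMeasure (c := c) (Lp.memLp v)).coeFn_toLp]
    with t h1 h2
  rw [h1, h2, ← mul_assoc, mul_comm (expWeight (-c) t), expWeight_mul_expWeight_neg, one_mul]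

/-- The unitary map `ℍ_c → L²(ℝ)` that diagonalizes the momentum operator. -/
noncomputable def momentumUnitary (c : ℝ) : WeightedL2 c ≃ₗᵢ[ℂ] Lp ℂ 2 (volume : Measure ℝ) :=
  (LinearIsometryEquiv.ofSurjective (weightLI c) (weightLI_surjective c)).trans
    (Lp.fourierTransformₗᵢ ℝ ℂ)

theorem momentumUnitary_apply (c : ℝ) (u : WeightedL2 c) :
    momentumUnitary c u = 𝓕 (weightLI c u) := rfl

/-- By the product rule `(e^{-ct} g)' = e^{-ct} (g' - c g)`, so conjugation by the weight turns `∂_c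
- c` into plain differentiation. -/
theorem mem_shiftGraph_iff {c : ℝ} (x y : WeightedL2 c) :
    (x, y) ∈ shiftGraph c ↔ ∀ᵐ ξ : ℝ, momentumUnitary c (y - (c : ℂ) • x) ξ =
      2 * π * Complex.I * ξ * momentumUnitary c x ξ := by
  rw [momentumUnitary_apply, momentumUnitary_apply, ← exists_isLocallyAC_iff_fourier]
  have hsub : weightLI c (y - (c : ℂ) • x) =ᵐ[volume]
      fun t => expWeight (-c) t * (y t - c * x t) := by
    filter_upwards [coeFn_weightLI (y - (c : ℂ) • x),
      (weightMeasure_ae_iff c).1 (Lp.coeFn_sub y ((c : ℂ) • x)),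
      (weightMeasure_ae_iff c).1 (Lp.coeFn_smul (c : ℂ) x)] with t h1 h2 h3
    rw [h1, h2, Pi.sub_apply, h3, Pi.smul_apply, smul_eq_mul]
  have hx := coeFn_weightLI x
  constructor
  · rintro ⟨g, hg, h1, h2⟩
    rw [EventuallyEq, weightMeasure_ae_iff] at h1 h2
    refine ⟨fun t => expWeight (-c) t * g t, (isLocallyAC_expWeight _).mul hg, ?_, ?_⟩
    · filter_upwards [hx, h1] with t h3 h4
      rw [h3, h4]
    · filter_upwards [hsub, h1, h2, hg.ae_hasDerivAt] with t h3 h4 h5 h6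
      rw [h3, ((hasDerivAt_expWeight (-c) t).fun_mul h6).deriv]
      rw [h4, h5]
      push_cast
      ring
  · rintro ⟨g, hg, h1, h2⟩
    refine ⟨fun t => expWeight c t * g t, (isLocallyAC_expWeight _).mul hg, ?_, ?_⟩
    · rw [EventuallyEq, weightMeasure_ae_iff]
      filter_upwards [hx, h1] with t h3 h4
      rw [← h4, h3, ← mul_assoc, expWeight_mul_expWeight_neg, one_mul]
    · rw [EventuallyEq, weightMeasure_ae_iff]
      filter_upwards [hsub, hx, h1, h2, hg.ae_hasDerivAt] with t h3 h3' h4 h5 h6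
      rw [((hasDerivAt_expWeight c t).fun_mul h6).deriv, ← h4, ← h5, h3, h3']
      linear_combination (-(y t)) * expWeight_mul_expWeight_neg c t

theorem mem_domain_momentumOperator {c : ℝ} (x : WeightedL2 c) :
    x ∈ (momentumOperator c).domain ↔ ∃ y, (x, y) ∈ shiftGraph c := by
  rw [momentumOperator, LinearPMap.smul_domain, LinearPMap.vadd_domain, infinitesimalShift,
    Submodule.toLinearPMap_domain, Submodule.mem_map]
  constructor
  · rintro ⟨⟨x', y⟩, h, rfl⟩
    exact ⟨y, h⟩
  · rintro ⟨y, h⟩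
    exact ⟨(x, y), h, rfl⟩

/-- The momentum operator acts as multiplication by `2πξ` after the unitary transformation. -/
theorem momentumUnitary_momentumOperator {c : ℝ} (x : (momentumOperator c).domain) :
    ∀ᵐ ξ : ℝ, momentumUnitary c (momentumOperator c x) ξ =
      2 * π * ξ * momentumUnitary c (x : WeightedL2 c) ξ := by
  have hx : (x : WeightedL2 c) ∈ (infinitesimalShift c).domain := x.2
  have hg : ((x : WeightedL2 c), infinitesimalShift c ⟨x, hx⟩) ∈ shiftGraph c :=
    Submodule.mem_graph_toLinearPMap (shiftGraph_single_valued c) ⟨x, hx⟩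
  have hV : momentumOperator c x = Complex.I⁻¹ •
      (infinitesimalShift c ⟨x, hx⟩ - (c : ℂ) • (x : WeightedL2 c)) := by
    change Complex.I⁻¹ • ((-(c : ℂ)) • (x : WeightedL2 c) + infinitesimalShift c ⟨x, hx⟩) = _
    congr 1
    module
  rw [hV, map_smul]
  filter_upwards [(mem_shiftGraph_iff _ _).1 hg, Lp.coeFn_smul Complex.I⁻¹
    (momentumUnitary c (infinitesimalShift c ⟨x, hx⟩ - (c : ℂ) • (x : WeightedL2 c)))]
    with ξ h1 h2
  rw [h2, Pi.smul_apply, h1, smul_eq_mul]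
  field_simp

theorem measurable_two_pi_mul : Measurable fun ξ : ℝ => (2 * π * ξ : ℂ) := by fun_prop

/-- The spectral resolution of the momentum operator. -/
noncomputable def momentumResolution (c : ℝ) : ResolutionOfIdentity (WeightedL2 c) :=
  multiplicationResolution (momentumUnitary c) measurable_two_pi_mul

theorem diagMeasure_momentumResolution {c : ℝ} (x : WeightedL2 c) :
    (momentumResolution c).diagMeasure x =
      (volume.withDensity fun ξ => ‖momentumUnitary c x ξ‖ₑ ^ 2).map
        fun ξ : ℝ => (2 * π * ξ : ℂ) :=
  diagMeasure_multiplicationResolution _ _ _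

theorem isIntegral_momentumResolution (c : ℝ) :
    (momentumResolution c).IsIntegral (fun z => z) (momentumOperator c) := by
  have hu : ∀ x : WeightedL2 c, AEMeasurable (fun ξ => ‖momentumUnitary c x ξ‖ₑ ^ 2) volume :=
    fun x => (Lp.aestronglyMeasurable _).enorm.pow_const 2
  refine ⟨fun x => ?_, fun x => ?_⟩
  · rw [diagMeasure_momentumResolution, lintegral_map (by fun_prop) measurable_two_pi_mul,
      lintegral_withDensity_eq_lintegral_mul₀ (hu x) (by fun_prop)]
    have h1 : ∀ ξ : ℝ, ((fun ξ => ‖momentumUnitary c x ξ‖ₑ ^ 2) *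
        fun ξ : ℝ => ‖(2 * π * ξ : ℂ)‖ₑ ^ 2) ξ = ‖2 * π * ξ * momentumUnitary c x ξ‖ₑ ^ 2 := by
      intro ξ
      rw [Pi.mul_apply, enorm_mul _ (momentumUnitary c x ξ), mul_pow, mul_comm]
    simp only [h1]
    constructor
    · intro hx
      have h2 := momentumUnitary_momentumOperator ⟨x, hx⟩
      have h3 := ofReal_norm_sq_eq_lintegral (momentumUnitary c (momentumOperator c ⟨x, hx⟩))
      rw [lintegral_congr_ae (g := fun ξ : ℝ => ‖2 * π * ξ * momentumUnitary c x ξ‖ₑ ^ 2)] at h3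
      · rw [← h3]
        exact ENNReal.ofReal_lt_top
      · filter_upwards [h2] with ξ hξ
        rw [hξ]
    · intro hfin
      have hmem : MemLp (fun ξ : ℝ => 2 * π * Complex.I * ξ * momentumUnitary c x ξ) 2 volume := by
        refine ⟨?_, ?_⟩
        · exact (by fun_prop : Continuous fun ξ : ℝ =>
            (2 * π * Complex.I * ξ : ℂ)).aestronglyMeasurable.mul (Lp.aestronglyMeasurable _)
        · rw [eLpNorm_lt_top_iff_lintegral_rpow_enorm_lt_top (by norm_num) (by norm_num)]
          simp only [ENNReal.toReal_ofNat, ENNReal.rpow_ofNat]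
          refine lt_of_eq_of_lt (lintegral_congr fun ξ => ?_) hfin
          have hI : ‖Complex.I‖ₑ = 1 := by
            rw [← ofReal_norm, Complex.norm_I, ENNReal.ofReal_one]
          simp only [enorm_mul, hI, mul_one]
      rw [mem_domain_momentumOperator]
      -- The derivative of `x` is `c x` plus the vector with transform `2πiξ` times that of `x`.
      refine ⟨(momentumUnitary c).symm hmem.toLp + (c : ℂ) • x, ?_⟩
      rw [mem_shiftGraph_iff, add_sub_cancel_right, LinearIsometryEquiv.apply_symm_apply]
      exact hmem.coeFn_toLp
  · rw [diagMeasure_momentumResolution, integral_map measurable_two_pi_mul.aemeasurable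
      (by fun_prop), integral_withDensity_eq_integral_toReal_smul₀ (hu _)
      (Eventually.of_forall fun ξ => by simp), ← (momentumUnitary c).inner_map_map, L2.inner_def]
    refine integral_congr_ae ?_
    filter_upwards [momentumUnitary_momentumOperator x] with ξ hξ
    rw [hξ, ENNReal.toReal_pow, toReal_enorm, Complex.real_smul, RCLike.inner_apply, mul_assoc,
      RCLike.mul_conj]
    push_cast
    exact mul_comm _ _

end Momentum

/-! ### The support of the spectral resolutions -/

section Support

open Filter Topology
open scoped Real

theorem diagMeasure_momentumResolution_apply {c : ℝ} (x : WeightedL2 c) {S : Set ℂ}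
    (hS : MeasurableSet S) :
    (momentumResolution c).diagMeasure x S =
      volume.withDensity (fun ξ => ‖momentumUnitary c x ξ‖ₑ ^ 2) {ξ : ℝ | (2 * π * ξ : ℂ) ∈ S} := by
  rw [diagMeasure_momentumResolution, Measure.map_apply measurable_two_pi_mul hS]
  rfl

theorem momentumResolution_null {c : ℝ} {S : Set ℂ} (hS : MeasurableSet S)
    (h : volume {ξ : ℝ | (2 * π * ξ : ℂ) ∈ S} = 0) (x : WeightedL2 c) :
    (momentumResolution c).diagMeasure x S = 0 := by
  rw [diagMeasure_momentumResolution_apply x hS]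
  exact withDensity_absolutelyContinuous _ _ h

/-- The witness has as transform the indicator of the interval where `2πξ` is within `δ` of `t`;
thus the support is all of `ℝ`. -/
theorem exists_momentumResolution_ball_ne_zero (c t : ℝ) {δ : ℝ} (hδ : 0 < δ) :
    ∃ x, (momentumResolution c).diagMeasure x {z | ‖z - t‖ < δ} ≠ 0 := by
  have hS : MeasurableSet {z : ℂ | ‖z - t‖ < δ} :=
    measurableSet_lt (measurable_id'.sub_const _).norm measurable_const
  set B : Set ℝ := Metric.ball (t / (2 * π)) (δ / (2 * π)) with hB
  have hBm : MeasurableSet B := measurableSet_ball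
  have hBf : volume B ≠ ∞ := measure_ball_lt_top.ne
  let u : Lp ℂ 2 (volume : Measure ℝ) := indicatorConstLp 2 hBm hBf 1
  refine ⟨(momentumUnitary c).symm u, fun h => ?_⟩
  rw [diagMeasure_momentumResolution_apply _ hS, LinearIsometryEquiv.apply_symm_apply] at h
  have hsub : B ⊆ {ξ : ℝ | (2 * π * ξ : ℂ) ∈ {z : ℂ | ‖z - t‖ < δ}} := by
    intro ξ hξ
    rw [hB, Metric.mem_ball, Real.dist_eq, lt_div_iff₀ (by positivity)] at hξ
    have h1 : (2 * π * ξ : ℂ) - t = ((2 * π * ξ - t : ℝ) : ℂ) := by push_cast; rfl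
    simp only [Set.mem_ofPred_eq, h1, Complex.norm_real, Real.norm_eq_abs]
    refine lt_of_eq_of_lt ?_ hξ
    rw [← abs_of_pos (show 0 < 2 * π by positivity), ← abs_mul, sub_mul,
      abs_of_pos (show 0 < 2 * π by positivity), div_mul_cancel₀ _ (by positivity), mul_comm ξ]
  have h2 := measure_mono_null hsub h
  rw [withDensity_apply _ hBm, setLIntegral_congr_fun_ae (g := fun _ => 1) hBm] at h2
  · rw [setLIntegral_one] at h2
    exact (Metric.measure_ball_pos volume _ (by positivity)).ne' h2
  · filter_upwards [indicatorConstLp_coeFn (p := 2) (hs := hBm) (hμs := hBf) (c := (1 : ℂ))]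
      with ξ h3 hξ
    rw [h3, Set.indicator_of_mem hξ]
    simp

variable {c : ℝ} {E : ResolutionOfIdentity (WeightedL2 c)}

theorem exists_ball_ne_zero_of_isIntegral_momentumOperator
    (hE : E.IsIntegral (fun z => z) (momentumOperator c)) (t : ℝ) {δ : ℝ} (hδ : 0 < δ) :
    ∃ x, E.diagMeasure x {z | ‖z - t‖ < δ} ≠ 0 := by
  obtain ⟨x, hx⟩ := exists_momentumResolution_ball_ne_zero c t hδ
  by_contra! h
  exact hx ((hE.null_iff measurable_id' measurable_id' (isIntegral_momentumResolution c) t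
    hδ.le).1 h x)

/-- The disk of radius `|Im a|` about a nonreal `a` misses the real line, so it is null for the
explicit resolution and hence for `E`. -/
theorem null_im_ne_zero_of_isIntegral_momentumOperator
    (hE : E.IsIntegral (fun z => z) (momentumOperator c)) (x : WeightedL2 c) :
    E.diagMeasure x {z | z.im ≠ 0} = 0 := by
  refine measure_null_of_locally_null _ fun a ha => ?_
  have ha' : 0 < |a.im| := abs_pos.2 ha
  refine ⟨{z | ‖z - a‖ < |a.im|}, mem_nhdsWithin_of_mem_nhds ?_, ?_⟩
  · have h1 : {z | ‖z - a‖ < |a.im|} = Metric.ball a |a.im| := by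
      ext z
      simp [dist_eq_norm]
    rw [h1]
    exact Metric.ball_mem_nhds a ha'
  · refine (hE.null_iff measurable_id' measurable_id' (isIntegral_momentumResolution c) a
      ha'.le).2 (momentumResolution_null ?_ ?_) x
    · exact measurableSet_lt (measurable_id'.sub_const _).norm measurable_const
    · convert measure_empty (μ := volume) using 2
      refine Set.eq_empty_of_forall_notMem fun ξ hξ => ?_
      have h1 : ‖(2 * π * ξ : ℂ) - a‖ < |a.im| := hξ
      have h2 := Complex.abs_im_le_norm ((2 * π * ξ : ℂ) - a)
      have h3 : ((2 * π * ξ : ℂ) - a).im = -a.im := by simp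
      rw [h3, abs_neg] at h2
      linarith

/-- For the explicit resolution, `2πξ = a` has at most one solution. Null disks say nothing about
points of the support, hence the separate comparison of atoms. -/
theorem null_singleton_of_isIntegral_momentumOperator
    (hE : E.IsIntegral (fun z => z) (momentumOperator c)) (a : ℂ) (x : WeightedL2 c) :
    E.diagMeasure x {a} = 0 := by
  refine (isIntegral_momentumResolution c).singleton_null hE (fun y => ?_) x
  refine momentumResolution_null (measurableSet_singleton a) ?_ y
  refine Set.Subsingleton.measure_zero (fun ξ hξ η hη => ?_) volume
  have h1 : (2 * π * ξ : ℂ) = 2 * π * η :=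
    (Set.mem_singleton_iff.1 hξ).trans (Set.mem_singleton_iff.1 hη).symm
  exact_mod_cast mul_left_cancel₀ (by simp [Real.pi_ne_zero]) h1

theorem null_re_mem_finite_of_isIntegral_momentumOperator
    (hE : E.IsIntegral (fun z => z) (momentumOperator c)) {F : Set ℝ} (hF : F.Finite)
    (x : WeightedL2 c) : E.diagMeasure x {z | z.re ∈ F} = 0 := by
  have hsub : {z : ℂ | z.re ∈ F} ⊆ {z | z.im ≠ 0} ∪ ⋃ t ∈ F, {(t : ℂ)} := by
    intro z hz
    by_cases h : z.im = 0
    · refine Or.inr (Set.mem_biUnion hz ?_)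
      exact Complex.ext rfl (by simpa using h)
    · exact Or.inl h
  refine measure_mono_null hsub (measure_union_null
    (null_im_ne_zero_of_isIntegral_momentumOperator hE x) ?_)
  exact (measure_biUnion_null_iff hF.countable).2 fun t _ =>
    null_singleton_of_isIntegral_momentumOperator hE t x

theorem measurable_of_continuousOn_compl_finite {φ : ℝ → ℝ} {F : Set ℝ} (hF : F.Finite)
    (hφ : ContinuousOn φ Fᶜ) : Measurable φ := by
  refine measurable_of_isOpen fun O hO => ?_
  have h1 : φ ⁻¹' O = (Fᶜ ∩ φ ⁻¹' O) ∪ (F ∩ φ ⁻¹' O) := by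
    rw [← Set.union_inter_distrib_right, Set.compl_union_self, Set.univ_inter]
  rw [h1]
  exact (hφ.isOpen_inter_preimage hF.isClosed.isOpen_compl hO).measurableSet.union
    (hF.subset Set.inter_subset_left).measurableSet

theorem measurable_riemannZeta : Measurable riemannZeta :=
  measurable_of_continuousOn_compl_singleton 1 fun _ hs =>
    (differentiableAt_riemannZeta hs).continuousAt.continuousWithinAt

/-- The part of the line `Re s = c` with `T₀ ≤ |Im s| ≤ T`. -/
def truncatedLine (c T₀ T : ℝ) : Set ℂ := {s | s.re = c ∧ T₀ ≤ |s.im| ∧ |s.im| ≤ T}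

theorem isClosed_truncatedLine (c T₀ T : ℝ) : IsClosed (truncatedLine c T₀ T) :=
  (isClosed_eq Complex.continuous_re continuous_const).inter
    ((isClosed_le continuous_const Complex.continuous_im.abs).inter
      (isClosed_le Complex.continuous_im.abs continuous_const))

theorem isCompact_truncatedLine (c T₀ T : ℝ) : IsCompact (truncatedLine c T₀ T) := by
  refine (isCompact_closedBall (0 : ℂ) (|c| + T)).of_isClosed_subset
    (isClosed_truncatedLine c T₀ T) fun s hs => ?_
  rw [mem_closedBall_zero_iff]
  refine (Complex.norm_le_abs_re_add_abs_im s).trans ?_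
  rw [hs.1]
  linarith [hs.2.2]

/-- The truncated spectral operator is the integral of `ζ` with respect to a resolution of the
identity with support `{c + iτ : T₀ ≤ |τ| ≤ T}`. -/
theorem exists_resolution_truncatedSpectralOperator {T₀ T : ℝ} {φ : ℝ → ℝ}
    (hφ : IsAdmissibleCutoff c T₀ T φ) :
    ∃ E' : ResolutionOfIdentity (WeightedL2 c),
      E'.IsIntegral riemannZeta (truncatedSpectralOperator c φ) ∧
      (∀ x, E'.diagMeasure x (truncatedLine c T₀ T)ᶜ = 0) ∧
      ∀ s ∈ truncatedLine c T₀ T, ∀ δ > 0, ∃ x, E'.diagMeasure x {z | ‖z - s‖ < δ} ≠ 0 := by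
  obtain ⟨F, hF, -, hcont, hcl, -⟩ := hφ
  have hφm : Measurable φ := measurable_of_continuousOn_compl_finite hF hcont
  have hfm : Measurable fun z : ℂ => (φ z.re : ℂ) :=
    Complex.measurable_ofReal.comp (hφm.comp Complex.measurable_re)
  have hhm : Measurable fun z : ℂ => (c : ℂ) + Complex.I * (φ z.re : ℂ) :=
    (hfm.const_mul _).const_add _
  obtain ⟨E₁, hV, hφV⟩ := isFunctionOf_functionalCalculus hfm (isIntegral_momentumResolution c)
  have hN : E₁.IsIntegral (fun z => (c : ℂ) + Complex.I * (φ z.re : ℂ)) (truncatedShift c φ) :=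
    hφV.affine hfm c Complex.I_ne_zero
  -- `E'` need not be the image of `E₁`; both represent the truncated shift, so only their null
  -- disks are compared.
  obtain ⟨E', hE', hζ⟩ := isFunctionOf_functionalCalculus measurable_riemannZeta
    (hN.map measurable_id' hhm)
  refine ⟨E', hζ, fun x => ?_, fun s hs δ hδ => ?_⟩
  · refine measure_null_of_locally_null _ fun a ha => ?_
    obtain ⟨δ, hδ, hball⟩ := Metric.isOpen_iff.1 (isClosed_truncatedLine c T₀ T).isOpen_compl a ha
    have hball' : Metric.ball a δ = {z | ‖z - a‖ < δ} := by
      ext z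
      simp [dist_eq_norm]
    refine ⟨Metric.ball a δ, mem_nhdsWithin_of_mem_nhds (Metric.ball_mem_nhds a hδ), ?_⟩
    rw [hball'] at hball ⊢
    refine (hN.null_iff hhm measurable_id' hE' a hδ.le).1 (fun y => ?_) x
    refine measure_mono_null (fun z hz => ?_)
      (null_re_mem_finite_of_isIntegral_momentumOperator hV hF y)
    by_contra hzF
    have h1 : φ z.re ∈ {τ : ℝ | T₀ ≤ |τ| ∧ |τ| ≤ T} := by
      rw [← hcl]
      exact subset_closure ⟨z.re, hzF, rfl⟩
    exact hball hz (by simpa [truncatedLine] using h1)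
  -- Some `φ t` with `t ∉ F` is close to `Im s`, and continuity on the open set `Fᶜ` keeps `φ` close
  -- on an interval about `t`, which carries spectral mass.
  · have h1 : s.im ∈ closure (φ '' Fᶜ) := by
      rw [hcl]
      exact hs.2
    obtain ⟨_, ⟨t, ht, rfl⟩, hts⟩ := Metric.mem_closure_iff.1 h1 δ hδ
    have hopen := hcont.isOpen_inter_preimage hF.isClosed.isOpen_compl
      (Metric.isOpen_ball (x := s.im) (ε := δ))
    obtain ⟨r, hr, hball⟩ := Metric.isOpen_iff.1 hopen t ⟨ht, by
      rw [Set.mem_preimage, Metric.mem_ball, dist_comm]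
      exact hts⟩
    by_contra! h
    have h2 := (hN.null_iff hhm measurable_id' hE' s hδ.le).2 h
    obtain ⟨x, hx⟩ := exists_ball_ne_zero_of_isIntegral_momentumOperator hV t hr
    refine hx (measure_mono_null (fun z hz => ?_) (h2 x))
    have hz' : ‖z - t‖ < r := hz
    have h3 : z.re ∈ Metric.ball t r := by
      rw [Metric.mem_ball, Real.dist_eq]
      refine lt_of_le_of_lt ?_ hz'
      simpa using Complex.abs_re_le_norm (z - t)
    have h4 := (hball h3).2
    rw [Set.mem_preimage, Metric.mem_ball, Real.dist_eq] at h4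
    have h5 : (c : ℂ) + Complex.I * (φ z.re : ℂ) - s = Complex.I * ((φ z.re - s.im : ℝ) : ℂ) := by
      refine Complex.ext ?_ ?_
      · simp [hs.1]
      · simp
    change ‖(c : ℂ) + Complex.I * (φ z.re : ℂ) - s‖ < δ
    rw [h5, norm_mul, Complex.norm_I, one_mul, Complex.norm_real]
    exact h4

/-- The truncated spectral operator is invertible if `ζ` has no zeros on the truncated line. -/
theorem isInvertibleOperator_truncatedSpectralOperator_of_forall_ne_zero {T₀ T : ℝ} (hT₀ : 0 < T₀)
    {φ : ℝ → ℝ} (hφ : IsAdmissibleCutoff c T₀ T φ)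
    (h : ∀ s ∈ truncatedLine c T₀ T, riemannZeta s ≠ 0) :
    IsInvertibleOperator (truncatedSpectralOperator c φ) := by
  obtain ⟨E', hζ, hnull, -⟩ := exists_resolution_truncatedSpectralOperator hφ
  rw [hζ.isInvertibleOperator_iff measurable_riemannZeta]
  have hcont : ContinuousOn (fun s => ‖riemannZeta s‖) (truncatedLine c T₀ T) := by
    intro s hs
    -- Positivity of `T₀` keeps the truncated line off the pole, also when `c = 1`.
    have hs1 : s ≠ 1 := by
      rintro rfl
      have := hs.2.1
      simp at this
      linarith
    exact (differentiableAt_riemannZeta hs1).continuousAt.continuousWithinAt.norm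
  obtain ⟨ε, hε, hle⟩ : ∃ ε > 0, ∀ s ∈ truncatedLine c T₀ T, ε ≤ ‖riemannZeta s‖ := by
    rcases (truncatedLine c T₀ T).eq_empty_or_nonempty with he | hne
    · exact ⟨1, one_pos, by simp [he]⟩
    · obtain ⟨s₀, hs₀, hmin⟩ := (isCompact_truncatedLine c T₀ T).exists_isMinOn hne hcont
      exact ⟨‖riemannZeta s₀‖, norm_pos_iff.2 (h s₀ hs₀), fun s hs => hmin hs⟩
  refine ⟨ε, hε, fun x => measure_mono_null ?_ (hnull x)⟩
  intro s hs hs'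
  have hs1 : ‖riemannZeta s‖ < ε := hs
  exact absurd (hle s hs') (not_le.2 hs1)

/-- Near a zero `|ζ|` drops below any `ε` on a disk of nonzero spectral mass. The case `T₀ = 0` is
included, as the assigned value `ζ(1)` is nonzero. -/
theorem riemannZeta_ne_zero_of_isInvertibleOperator {T₀ T : ℝ} {φ : ℝ → ℝ}
    (hφ : IsAdmissibleCutoff c T₀ T φ)
    (h : IsInvertibleOperator (truncatedSpectralOperator c φ)) {s : ℂ}
    (hs : s ∈ truncatedLine c T₀ T) : riemannZeta s ≠ 0 := by
  intro h0
  obtain ⟨E', hζ, -, hpos⟩ := exists_resolution_truncatedSpectralOperator hφ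
  obtain ⟨ε, hε, hnull⟩ := (hζ.isInvertibleOperator_iff measurable_riemannZeta).1 h
  have hs1 : s ≠ 1 := by
    rintro rfl
    exact riemannZeta_one_ne_zero h0
  have hc := (differentiableAt_riemannZeta hs1).continuousAt.norm
  have hev : ∀ᶠ z in 𝓝 s, ‖riemannZeta z‖ < ε :=
    hc.eventually_lt continuousAt_const (by simpa [h0] using hε)
  obtain ⟨δ, hδ, hball⟩ := Metric.eventually_nhds_iff.1 hev
  obtain ⟨x, hx⟩ := hpos s hs δ hδ
  refine hx (measure_mono_null (fun z hz => ?_) (hnull x))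
  exact hball (by rw [dist_eq_norm]; exact hz)

end Support

/-! ### Existence of cut-off functions -/

section Cutoff

open Filter Topology

theorem isAdmissibleCutoff_sin (c : ℝ) {T : ℝ} (hT : 0 < T) :
    IsAdmissibleCutoff c 0 T fun x => T * Real.sin x := by
  have hr : (fun x => T * Real.sin x) '' (∅ : Set ℝ)ᶜ = Set.Icc (-T) T := by
    ext y
    simp only [Set.compl_empty, Set.image_univ, Set.mem_range, Set.mem_Icc]
    constructor
    · rintro ⟨x, rfl⟩
      constructor <;> nlinarith [Real.neg_one_le_sin x, Real.sin_le_one x]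
    · rintro ⟨h1, h2⟩
      refine ⟨Real.arcsin (y / T), ?_⟩
      rw [Real.sin_arcsin (by rw [le_div_iff₀ hT]; linarith) (by rw [div_le_iff₀ hT]; linarith)]
      field_simp
  refine ⟨∅, Set.finite_empty, fun _ => rfl, by fun_prop, ?_, fun _ => ?_⟩
  · rw [hr, isClosed_Icc.closure_eq]
    ext y
    simp [abs_le]
  · exact ⟨Set.univ, fun z => T * Complex.sin z, isOpen_univ, by fun_prop, fun x _ => by simp⟩

/-- A cut-off function with a jump at the origin. -/
noncomputable def jumpCutoff (T₀ T x : ℝ) : ℝ :=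
  if 0 < x then T₀ + (T - T₀) * (x ^ 2 / (1 + x ^ 2)) else -(T₀ + (T - T₀) * (x ^ 2 / (1 + x ^ 2)))

/-- `x² / (1 + x²)` maps each open half-line onto `(0, 1)`; the jump supplies the sign. -/
theorem image_jumpCutoff {T₀ T : ℝ} (hT : T₀ < T) :
    jumpCutoff T₀ T '' {0}ᶜ = Set.Ioo T₀ T ∪ Set.Ioo (-T) (-T₀) := by
  have hpos : ∀ x : ℝ, x ≠ 0 → T₀ + (T - T₀) * (x ^ 2 / (1 + x ^ 2)) ∈ Set.Ioo T₀ T := by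
    intro x hx
    have hx2 : 0 < x ^ 2 := by positivity
    have h1 : 0 < x ^ 2 / (1 + x ^ 2) := by positivity
    have h2 : x ^ 2 / (1 + x ^ 2) < 1 := by rw [div_lt_one (by positivity)]; linarith
    constructor <;> nlinarith
  have hsurj : ∀ y ∈ Set.Ioo T₀ T, ∃ x > 0, T₀ + (T - T₀) * (x ^ 2 / (1 + x ^ 2)) = y := by
    rintro y ⟨h1, h2⟩
    have h3 : 0 < (y - T₀) / (T - y) := div_pos (by linarith) (by linarith)
    refine ⟨√((y - T₀) / (T - y)), Real.sqrt_pos.2 h3, ?_⟩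
    rw [Real.sq_sqrt h3.le]
    have h4 : T - y ≠ 0 := by linarith
    have h5 : T - T₀ ≠ 0 := by linarith
    have h6 : 1 + (y - T₀) / (T - y) = (T - T₀) / (T - y) := by field_simp; ring
    rw [h6]
    field_simp
    ring
  ext y
  constructor
  · rintro ⟨x, hx, rfl⟩
    have hx0 : x ≠ 0 := hx
    have h1 := hpos x hx0
    unfold jumpCutoff
    split_ifs with h
    · exact Or.inl h1
    · exact Or.inr ⟨neg_lt_neg h1.2, neg_lt_neg h1.1⟩
  · rintro (h | h)
    · obtain ⟨x, hx, rfl⟩ := hsurj y h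
      exact ⟨x, hx.ne', if_pos hx⟩
    · obtain ⟨x, hx, hxy⟩ := hsurj (-y) ⟨by linarith [h.2], by linarith [h.1]⟩
      refine ⟨-x, (neg_neg_of_pos hx).ne, ?_⟩
      rw [jumpCutoff, if_neg (by linarith), neg_sq, hxy, neg_neg]

theorem isAdmissibleCutoff_jumpCutoff (c : ℝ) {T₀ T : ℝ} (h0 : 0 < T₀) (hT : T₀ < T) :
    IsAdmissibleCutoff c T₀ T (jumpCutoff T₀ T) := by
  refine ⟨{0}, Set.finite_singleton 0, fun h => absurd h h0.ne', ?_, ?_, fun _ => ?_⟩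
  · intro x hx
    have hx0 : x ≠ 0 := hx
    have hc : ContinuousAt (fun x : ℝ => T₀ + (T - T₀) * (x ^ 2 / (1 + x ^ 2))) x := by
      have : (1 + x ^ 2) ≠ 0 := by positivity
      fun_prop (disch := assumption)
    refine ContinuousAt.continuousWithinAt ?_
    rcases lt_or_gt_of_ne hx0 with h | h
    · refine hc.neg.congr ?_
      filter_upwards [gt_mem_nhds h] with y hy
      exact (if_neg (not_lt.2 (le_of_lt hy))).symm
    · refine hc.congr ?_
      filter_upwards [lt_mem_nhds h] with y hy
      exact (if_pos hy).symm
  · rw [image_jumpCutoff hT, closure_union, closure_Ioo hT.ne, closure_Ioo (by linarith)]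
    ext y
    simp only [Set.mem_union, Set.mem_Icc, Set.mem_ofPred_eq]
    constructor
    · rintro (⟨h1, h2⟩ | ⟨h1, h2⟩)
      · rw [abs_of_pos (by linarith)]
        exact ⟨h1, h2⟩
      · rw [abs_of_neg (by linarith)]
        exact ⟨by linarith, by linarith⟩
    · rintro ⟨h1, h2⟩
      rcases le_total 0 y with h | h
      · rw [abs_of_nonneg h] at h1 h2
        exact Or.inl ⟨h1, h2⟩
      · rw [abs_of_nonpos h] at h1 h2
        exact Or.inr ⟨by linarith, by linarith⟩
  · let p : ℂ → ℂ := fun z => T₀ + (T - T₀) * (z ^ 2 / (1 + z ^ 2))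
    have hp : ∀ z : ℂ, z.re ≠ 0 → DifferentiableAt ℂ p z := by
      intro z hz
      -- The poles `±i` lie on the imaginary axis, which separates the two half-planes where the
      -- branches are holomorphic.
      have : 1 + z ^ 2 ≠ 0 := by
        intro h
        have h1 := congrArg Complex.re h
        have h2 := congrArg Complex.im h
        simp [pow_two] at h1 h2
        have h3 : z.im = 0 := by
          rcases mul_eq_zero.1 (show z.re * z.im = 0 by linarith) with h | h
          exacts [absurd h hz, h]
        rw [h3] at h1
        nlinarith [mul_self_pos.2 hz]
      fun_prop (disch := assumption)
    refine ⟨{z | z.re ≠ 0}, fun z => if 0 < z.re then p z else -p z,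
      isOpen_ne.preimage Complex.continuous_re, fun z hz => ?_, fun x hx => ⟨?_, ?_⟩⟩
    · have hz0 : z.re ≠ 0 := hz
      refine DifferentiableAt.differentiableWithinAt ?_
      rcases lt_or_gt_of_ne hz0 with h | h
      · refine (hp z hz0).neg.congr_of_eventuallyEq ?_
        filter_upwards [Complex.continuous_re.continuousAt.eventually (gt_mem_nhds h)] with w hw
        exact if_neg (not_lt.2 (le_of_lt hw))
      · refine (hp z hz0).congr_of_eventuallyEq ?_
        filter_upwards [Complex.continuous_re.continuousAt.eventually (lt_mem_nhds h)] with w hw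
        exact if_pos hw
    · simpa using hx
    · simp only [Complex.ofReal_re, jumpCutoff, p]
      split_ifs <;> push_cast <;> rfl

theorem exists_isAdmissibleCutoff (c : ℝ) {T₀ T : ℝ} (h0 : 0 ≤ T₀) (hT : T₀ < T) :
    ∃ φ, IsAdmissibleCutoff c T₀ T φ := by
  rcases h0.eq_or_lt with rfl | h
  · exact ⟨_, isAdmissibleCutoff_sin c hT⟩
  · exact ⟨_, isAdmissibleCutoff_jumpCutoff c h hT⟩

end Cutoff

/-! ### Almost invertibility -/

theorem AlmostInvertible.forSome {c : ℝ} (h : AlmostInvertible c) : AlmostInvertibleForSome c := by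
  obtain ⟨T₀, h0, h⟩ := h
  refine ⟨T₀, h0, fun T hT => ?_⟩
  obtain ⟨φ, hφ⟩ := exists_isAdmissibleCutoff c h0 hT
  exact ⟨φ, hφ, h T hT φ hφ⟩

theorem AlmostInvertibleForSome.finite_zeros {c : ℝ} (h : AlmostInvertibleForSome c) :
    {s : ℂ | s.re = c ∧ riemannZeta s = 0}.Finite := by
  obtain ⟨T₀, h0, h⟩ := h
  refine (isCompact_truncatedLine c 0 T₀).inter_riemannZetaZeros_finite.subset fun s hs => ?_
  refine ⟨⟨hs.1, abs_nonneg _, ?_⟩, hs.2⟩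
  by_contra! hlt
  -- With `T = |Im s|` the zero is an endpoint of the truncated line, which is closed.
  obtain ⟨φ, hφ, hinv⟩ := h |s.im| hlt
  exact riemannZeta_ne_zero_of_isInvertibleOperator hφ hinv ⟨hs.1, hlt.le, le_rfl⟩ hs.2

theorem almostInvertible_of_finite_zeros {c : ℝ}
    (h : {s : ℂ | s.re = c ∧ riemannZeta s = 0}.Finite) : AlmostInvertible c := by
  obtain ⟨M, hM⟩ := (h.image fun s => |s.im|).bddAbove
  -- The maximum with `0` makes `T₀` positive, avoiding the pole; the added `1` puts it strictly
  -- above every zero.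
  have hT₀ : 0 < max M 0 + 1 := by positivity
  refine ⟨max M 0 + 1, hT₀.le, fun T _ φ hφ => ?_⟩
  refine isInvertibleOperator_truncatedSpectralOperator_of_forall_ne_zero hT₀ hφ fun s hs hz => ?_
  have h1 : |s.im| ≤ M := hM ⟨s, ⟨hs.1, hz⟩, rfl⟩
  have h2 := hs.2.1
  linarith [le_max_left M 0]

theorem theorem5p6 (c : ℝ) (hc : 0 ≤ c) :
    (AlmostInvertible c ↔ {s : ℂ | s.re = c ∧ riemannZeta s = 0}.Finite) ∧
      (AlmostInvertibleForSome c ↔ {s : ℂ | s.re = c ∧ riemannZeta s = 0}.Finite) := by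
  exact ⟨⟨fun h => h.forSome.finite_zeros, almostInvertible_of_finite_zeros⟩,
    ⟨fun h => h.finite_zeros, fun h => (almostInvertible_of_finite_zeros h).forSome⟩⟩
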